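/- **Conventions.** All rings are commutative. For a scheme $X$, a sieve $H$ on $X$ is a class of morphisms $Y\to X$ of schemes closed under precomposition with arbitrary morphisms. Let $\mathcal C_H$ be the category whose objects are the members of $H$ and whose morphisms are morphisms of schemes over $X$. An $H$-presheaf is a presheaf on $\mathcal C_H$ of modules over $\mathcal O|_H\colon (Y\to X)\mapsto\Gamma(Y,\mathcal O_Y)$. For $f\colon Y\to X$ let $f^*H=\{k\colon Z\to Y \mid fk\in H\}$; for an $H$-presheaf $E$ let $f^*E$ be the $f^*H$-presheaf whose value at $k$ is the value of $E$ at $fk$, with the same restriction maps; and put $f^*(H,E)=(f^*H,f^*E)$. A *standard line bundle* on $X$ is a pair $(H,E)$ in which $H$ is a sieve on $X$ containing a Zariski open covering of $X$ and $E$ is an $H$-presheaf such that, for every $f\colon Y\to X$ in $H$, the module $E(Y)$ of sections over $f$ is equal to the standard free module $\Gamma(Y,\mathcal O_Y)^1$, and the map $\mathcal O_Y\to f^*E$ of presheaves of modules on the category of all schemes over $Y$ induced by the standard basis of $E(Y)$ is an isomorphism. For a sheaf of modules $\mathcal F$ on a scheme $X$, let $B\mathcal F$ be the presheaf of modules on the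 category of schemes over $X$ with $B\mathcal F(Y\xrightarrow{f}X)=\Gamma(Y,f^*\mathcal F)$ and with restriction maps $\Gamma(Y,f^*\mathcal F)\to\Gamma(Z,g^*f^*\mathcal F)\cong\Gamma(Z,(fg)^*\mathcal F)$ for $g\colon Z\to Y$. Let $B\mathcal F|_H$ be its restriction to $\mathcal C_H$. If $E$ is an $H$-presheaf and $\varphi_f\colon\mathcal O_Y\cong f^*E$ is an isomorphism of presheaves of modules on schemes over $Y$ for each $f\colon Y\to X$ in $H$, let $S_H^\varphi E$ be the $H$-presheaf whose module of sections over $f$ is $\Gamma(Y,\mathcal O_Y)^1$ and whose restriction map along $g\colon Z\to Y$ is $\varphi_{fg}(Z)^{-1}\circ E(g)\circ\varphi_f(Y)$. **The line bundle $\mathbf O(n)$.** Let $r\ge 0$ and $n\in\mathbb Z$. For a scheme $X$ let $\mathbb P^r_X=X\times_{\mathbb Z}\operatorname{Proj}\mathbb Z[x_0,\dots,x_r]$, and let $\mathcal O_{\mathbb P^r_X}(n)$ be the usual twisting sheaf, the inverse image of $\mathcal O(n)$ on $\operatorname{Proj}\mathbb Z[x_0,\dots,x_r]$. For $0\le k\le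 r$ let $i_k\colon U_k\to\mathbb P^r_X$ be the inclusion of the open subscheme $U_k=X\times_{\mathbb Z}\operatorname{Spec}\mathbb Z[x_0/x_k,\dots,x_r/x_k]$, and let $x_k^n\colon\mathcal O_{U_k}\cong i_k^*\mathcal O_{\mathbb P^r_X}(n)$ be multiplication by $x_k^n$. Let $H$ be the sieve on $\mathbb P^r_X$ generated by $i_0,\dots,i_r$. For $h\colon Z\to\mathbb P^r_X$ in $H$, let $k$ be the largest index such that $h$ factors as $h=i_kh_k$ with $h_k\colon Z\to U_k$. Let $\alpha_h$ be the isomorphism $$\mathcal O_Z\cong h_k^*\mathcal O_{U_k}\xrightarrow{\;h_k^*(x_k^n)\;}h_k^*i_k^*\mathcal O_{\mathbb P^r_X}(n)\cong h^*\mathcal O_{\mathbb P^r_X}(n),$$ and let $\varphi_h$ be the isomorphism $$\mathcal O_Z\cong B\mathcal O_Z\xrightarrow{\;B\alpha_h\;}Bh^*\mathcal O_{\mathbb P^r_X}(n)\cong h^*\bigl(B\mathcal O_{\mathbb P^r_X}(n)|_H\bigr)$$ of presheaves of modules on the category of schemes over $Z$; the unnamed isomorphisms are the canonical ones. Put $$\mathbf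 O_{\mathbb P^r_X}(n)=\bigl(H,\;S_H^{\varphi}\,(B\mathcal O_{\mathbb P^r_X}(n)|_H)\bigr).$$ **Proposition.** Let $r\ge 0$, let $n\in\mathbb Z$, let $f\colon Y\to X$ be a morphism of schemes, and let $g=f\times 1\colon\mathbb P^r_Y\to\mathbb P^r_X$ be the induced morphism. Then $\mathbf O_{\mathbb P^r_X}(n)$ and $\mathbf O_{\mathbb P^r_Y}(n)$ are standard line bundles, and $$g^*\mathbf O_{\mathbb P^r_X}(n)=\mathbf O_{\mathbb P^r_Y}(n).$$ This is an equality of pairs, that is, of the sieves, of all modules of sections and of all restriction maps, not merely a natural isomorphism. -/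

import Mathlib

open CategoryTheory Limits Opposite AlgebraicGeometry

universe u

noncomputable section

namespace StdBundle


/-- The structure morphism of an object of the category of schemes over `X`. -/
def str {X : Scheme.{u}} (Y : Over X) : Y.left ⟶ X := Y.hom

lemma str_w {X : Scheme.{u}} {Y Z : Over X} (g : Z ⟶ Y) : g.left ≫ str Y = str Z := Over.w g

/-- The category `C_H` attached to a sieve `H` on `X`: its objects are the morphisms `Y ⟶ X` in `H`, and
its morphisms are the morphisms of schemes over `X`. -/
abbrev SieveCat {X : Scheme.{u}} (H : Sieve X) : Type (u + 1) := H.arrows.category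

/-- The inclusion of `C_H` into the category of all schemes over `X`. -/
abbrev SieveCat.incl {X : Scheme.{u}} (H : Sieve X) : SieveCat H ⥤ Over X := ObjectProperty.ι _

/-- The ring `Γ(Y, 𝒪_Y)` of global functions. -/
def globRing (Y : Scheme.{u}) : RingCat.{u} := RingCat.of Γ(Y, ⊤)

/-- The homomorphism `Γ(Y, 𝒪_Y) → Γ(Z, 𝒪_Z)` induced by `g : Z ⟶ Y`. -/
def glob {Y Z : Scheme.{u}} (g : Z ⟶ Y) : globRing Y →+* globRing Z := (Scheme.Γ.map g.op).hom

lemma glob_id (Y : Scheme.{u}) : glob (𝟙 Y) = RingHom.id (globRing Y) :=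
  congrArg CommRingCat.Hom.hom (Scheme.Γ.map_id (op Y))

lemma glob_comp {Y Z W : Scheme.{u}} (k : W ⟶ Z) (g : Z ⟶ Y) :
    glob (k ≫ g) = (glob k).comp (glob g) :=
  congrArg CommRingCat.Hom.hom (Scheme.Γ.map_comp g.op k.op)

/-- The structure presheaf `𝒪` on the category of schemes over `X`, `(Y ⟶ X) ↦ Γ(Y, 𝒪_Y)`. -/
def bigRing (X : Scheme.{u}) : (Over X)ᵒᵖ ⥤ RingCat.{u} where
  obj Y := globRing Y.unop.left
  map g := RingCat.ofHom (glob g.unop.left)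
  map_id Y := by rw [unop_id, Over.id_left, glob_id]; rfl
  map_comp g k := by rw [unop_comp, Over.comp_left, glob_comp]; rfl

/-- Presheaves of `𝒪`-modules on the category of schemes over `X`. -/
abbrev BigPresheaf (X : Scheme.{u}) := PresheafOfModules.{u} (bigRing X)

/-- The restriction `𝒪|_H` of the structure presheaf to `C_H`. -/
def sieveRing {X : Scheme.{u}} (H : Sieve X) : (SieveCat H)ᵒᵖ ⥤ RingCat.{u} :=
  (SieveCat.incl H).op ⋙ bigRing X

/-- An `H`-presheaf: a presheaf of `𝒪|_H`-modules on `C_H`. -/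
abbrev HPresheaf {X : Scheme.{u}} (H : Sieve X) := PresheafOfModules.{u} (sieveRing H)

/-- The restriction `F|_H` of a presheaf of modules to `C_H`. -/
def BigPresheaf.restrict {X : Scheme.{u}} (F : BigPresheaf X) (H : Sieve X) : HPresheaf H :=
  (PresheafOfModules.pushforward₀ (SieveCat.incl H) (bigRing X)).obj F

/-- For `f : Y ⟶ X`, the functor `C_{f^* H} ⥤ C_H` sending `Z ⟶ Y` to its composite with `f`. -/
def SieveCat.post {X Y : Scheme.{u}} (f : Y ⟶ X) (H : Sieve X) : SieveCat (H.pullback f) ⥤ SieveCat H :=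
  ObjectProperty.lift _ (SieveCat.incl (H.pullback f) ⋙ Over.map f) (fun Z => Z.property)

/-- The pullback `f^* E` of an `H`-presheaf `E` along `f : Y ⟶ X`, an `f^* H`-presheaf: its value at
`k : Z ⟶ Y` is the value of `E` at `k ≫ f`, and likewise for restriction maps. -/
def HPresheaf.pullback {X Y : Scheme.{u}} (f : Y ⟶ X) {H : Sieve X} (E : HPresheaf H) :
    HPresheaf (H.pullback f) :=
  (PresheafOfModules.pushforward₀ (SieveCat.post f H) (sieveRing H)).obj E

section Relations

variable {R₁ R₂ R₃ R₄ : Type u} [Ring R₁] [Ring R₂] [Ring R₃] [Ring R₄]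
  {σ₁ : R₁ →+* R₂} {σ₂ : R₂ →+* R₃} {σ₃ : R₁ →+* R₃} {σ₀ : R₁ →+* R₁}
  {M₁ M₂ M₃ N₁ N₂ : Type u} [AddCommGroup M₁] [AddCommGroup M₂] [AddCommGroup M₃]
  [AddCommGroup N₁] [AddCommGroup N₂] [Module R₁ M₁] [Module R₂ M₂] [Module R₃ M₃]
  [Module R₁ N₁] [Module R₂ N₂]

/-- The semilinear endomorphism `f` is the identity map. -/
def ActsAsId (f : M₁ →ₛₗ[σ₀] M₁) : Prop := ∀ s, f s = s

/-- The semilinear map `h` is the composite `g ∘ f`. -/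
def ActsAsComp (f : M₁ →ₛₗ[σ₁] M₂) (g : M₂ →ₛₗ[σ₂] M₃) (h : M₁ →ₛₗ[σ₃] M₃) : Prop :=
  ∀ s, h s = g (f s)

/-- The linear equivalences `e₁` and `e₂` intertwine the semilinear maps `f` and `g`. -/
def Intertwines (f : M₁ →ₛₗ[σ₁] M₂) (g : N₁ →ₛₗ[σ₁] N₂) (e₁ : M₁ ≃ₗ[R₁] N₁)
    (e₂ : M₂ ≃ₗ[R₂] N₂) : Prop :=
  ∀ s, e₂ (f s) = g (e₁ s)

/-- The linear equivalences `e₁` and `e₂` intertwine the semilinear map `f` and the ring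
homomorphism `σ₁`. -/
def IntertwinesRing (f : M₁ →ₛₗ[σ₁] M₂) (e₁ : M₁ ≃ₗ[R₁] R₁) (e₂ : M₂ ≃ₗ[R₂] R₂) : Prop :=
  ∀ s, e₂ (f s) = σ₁ (e₁ s)

/-- A module isomorphic to `R` is isomorphic to `R¹`. -/
def toFinOne (e : M₁ ≃ₗ[R₁] R₁) : M₁ ≃ₗ[R₁] (Fin 1 → R₁) :=
  e.trans (LinearEquiv.funUnique (Fin 1) R₁ R₁).symm

end Relations

/-- Construct a presheaf of modules from its modules of sections and its semilinear restriction maps. -/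
def mkPresheaf {C : Type*} [Category C] (R : Cᵒᵖ ⥤ RingCat.{u})
    (obj : ∀ Z : Cᵒᵖ, ModuleCat.{u} (R.obj Z))
    (map : ∀ {Z W : Cᵒᵖ} (g : Z ⟶ W), obj Z →ₛₗ[(R.map g).hom] obj W)
    (map_id : ∀ Z : Cᵒᵖ, ActsAsId (map (𝟙 Z)))
    (map_comp : ∀ {Z W V : Cᵒᵖ} (g : Z ⟶ W) (k : W ⟶ V),
      ActsAsComp (map g) (map k) (map (g ≫ k))) : PresheafOfModules.{u} R where
  obj := obj
  map {Z W} g := ModuleCat.ofHom (Y := (ModuleCat.restrictScalars (R.map g).hom).obj (obj W))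
    { toFun := fun s => map g s
      map_add' := fun a b => map_add (map g) a b
      map_smul' := fun r a => (map g).map_smulₛₗ r a }
  map_id Z := by
    ext s
    exact map_id Z s
  map_comp g k := by
    ext s
    exact map_comp g k s

/-- Construct an isomorphism of presheaves of modules from isomorphisms of the modules of sections. -/
def mkIso {C : Type*} [Category C] {R : Cᵒᵖ ⥤ RingCat.{u}} {M N : PresheafOfModules.{u} R}
    (e : ∀ Z : Cᵒᵖ, M.obj Z ≃ₗ[R.obj Z] N.obj Z)
    (he : ∀ {Z W : Cᵒᵖ} (g : Z ⟶ W), Intertwines (M.restrictₛₗ g) (N.restrictₛₗ g) (e Z) (e W)) : M ≅ N :=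
  PresheafOfModules.isoMk (fun Z => (e Z).toModuleIso) (fun Z W g => by
    ext s
    exact he g s)

/-- Construct a morphism of presheaves of modules from maps of the modules of sections. -/
def mkHom {C : Type*} [Category C] {R : Cᵒᵖ ⥤ RingCat.{u}} {M N : PresheafOfModules.{u} R}
    (e : ∀ Z : Cᵒᵖ, M.obj Z →ₗ[R.obj Z] N.obj Z)
    (he : ∀ {Z W : Cᵒᵖ} (g : Z ⟶ W) (s : M.obj Z),
      e W (M.map g s) = N.map g (e Z s)) : M ⟶ N where
  app Z := ModuleCat.ofHom (e Z)
  naturality g := by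
    ext s
    exact he g s

/-- The free presheaf of modules `R^n`, with sections `R(Z)^n` and componentwise restriction maps. -/
def free {C : Type*} [Category C] (R : Cᵒᵖ ⥤ RingCat.{u}) (n : ℕ) : PresheafOfModules.{u} R :=
  mkPresheaf R (fun Z => ModuleCat.of (R.obj Z) (Fin n → R.obj Z))
    (fun g =>
      { toFun := fun a i => (R.map g).hom (a i)
        map_add' := fun a b => by funext i; exact map_add (R.map g).hom (a i) (b i)
        map_smul' := fun r a => by funext i; exact map_mul (R.map g).hom r (a i) })
    (fun Z s => by funext i; exact congr($(R.map_id Z) (s i)))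
    (fun g k s => by funext i; exact congr($(R.map_comp g k) (s i)))

/-- For `f : Y ⟶ X` in `H` and `k : Z ⟶ Y`, the morphism `k` from `k ≫ f` to `f` in `C_H`. -/
def SieveCat.toPost {X : Scheme.{u}} {H : Sieve X} (Y : SieveCat H)
    (Z : SieveCat (H.pullback (str Y.obj))) : (SieveCat.post (str Y.obj) H).obj Z ⟶ Y :=
  ObjectProperty.homMk (Over.homMk (str Z.obj))

/-- The restriction of a section of `E` over `f : Y ⟶ X` along `k : Z ⟶ Y`, as a section of `f^* E`
over `k`. -/
def pullSection {X : Scheme.{u}} {H : Sieve X} (E : HPresheaf H) (Y : SieveCat H)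
    (s : E.obj (op Y)) (Z : (SieveCat (H.pullback (str Y.obj)))ᵒᵖ) :
    (E.pullback (str Y.obj)).obj Z :=
  E.map (Y.toPost Z.unop).op s

lemma map_pullSection {X : Scheme.{u}} {H : Sieve X} (E : HPresheaf H) (Y : SieveCat H)
    (s : E.obj (op Y)) {Z W : (SieveCat (H.pullback (str Y.obj)))ᵒᵖ} (g : Z ⟶ W) :
    (E.pullback (str Y.obj)).map g (pullSection E Y s Z) = pullSection E Y s W := by
  have h : (Y.toPost W.unop).op = (Y.toPost Z.unop).op ≫
      ((SieveCat.post (str Y.obj) H).map g.unop).op := by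
    apply Quiver.Hom.unop_inj
    apply ObjectProperty.hom_ext
    ext
    exact (Over.w g.unop.hom).symm
  exact ((E.congr_map_apply h _).trans (E.map_comp_apply _ _ _)).symm

/-- The map `𝒪_Y^n ⟶ f^* E` determined by `n` sections of `E` over the object `f : Y ⟶ X` of `C_H`. -/
def homOfSections {X : Scheme.{u}} {H : Sieve X} (E : HPresheaf H) (Y : SieveCat H) {n : ℕ}
    (e : Fin n → E.obj (op Y)) :
    free (sieveRing (H.pullback (str Y.obj))) n ⟶ E.pullback (str Y.obj) :=
  mkHom (fun Z => Fintype.linearCombination ((sieveRing (H.pullback (str Y.obj))).obj Z)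
      (fun i => pullSection E Y (e i) Z))
    (fun {Z W} g s => by
      change ∑ i, (sieveRing (H.pullback (str Y.obj))).map g (s i) • pullSection E Y (e i) W =
        (E.pullback (str Y.obj)).restrictₛₗ g (∑ i, s i • pullSection E Y (e i) Z)
      rw [map_sum]
      refine Finset.sum_congr rfl fun i _ => ?_
      rw [LinearMap.map_smulₛₗ, PresheafOfModules.restrictₛₗ_apply, map_pullSection])

/-- At the object `f : Y ⟶ X` of `C_H`, the module `E(Y)` is equal to the standard free module
`Γ(Y, 𝒪_Y)^n`, and the map `𝒪_Y^n ⟶ f^* E` induced by the standard basis is an isomorphism. -/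
def IsStandardFreeAt {X : Scheme.{u}} {H : Sieve X} (E : HPresheaf H) (Y : SieveCat H) (n : ℕ) : Prop :=
  ∃ h : ModuleCat.of ((sieveRing H).obj (op Y)) (Fin n → (sieveRing H).obj (op Y)) = E.obj (op Y),
    IsIso (homOfSections E Y fun i => (eqToHom h).hom (Pi.single i 1))

/-- For `f : Y ⟶ X` in `H`, the identity of `Y` as an object of `C_{f^* H}`. -/
def SieveCat.idObj {X : Scheme.{u}} {H : Sieve X} (Y : SieveCat H) :
    SieveCat (H.pullback (str Y.obj)) :=
  ⟨Over.mk (𝟙 Y.obj.left), by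
    change H.arrows (𝟙 _ ≫ (str Y.obj))
    rw [Category.id_comp]
    exact Y.property⟩

/-- The functor sending `f : Y ⟶ X` to `𝟙 ≫ f : Y ⟶ X` (which is the same morphism). -/
def SieveCat.same {X : Scheme.{u}} (H : Sieve X) : SieveCat H ⥤ SieveCat H where
  obj Y := (SieveCat.post (str Y.obj) H).obj Y.idObj
  map {Z Y} g := ObjectProperty.homMk (Over.homMk g.hom.left (by
    change g.hom.left ≫ 𝟙 _ ≫ _ = 𝟙 _ ≫ _
    rw [Category.id_comp, Category.id_comp]
    exact Over.w g.hom))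

/-- The component `φ_f(Y) : Γ(Y, 𝒪_Y)^{n_f} ≃ (f^* E)(Y) = E(Y)` at the identity of `Y`. -/
def standardizeEquiv {X : Scheme.{u}} {H : Sieve X} {E : HPresheaf H} {n : SieveCat H → ℕ}
    (φ : ∀ Y : SieveCat H,
      free (sieveRing (H.pullback (str Y.obj))) (n Y) ≅ E.pullback (str Y.obj)) (Y : SieveCat H) :
    (free (sieveRing (H.pullback (str Y.obj))) (n Y)).obj (op Y.idObj) ≃ₗ[
      (sieveRing (H.pullback (str Y.obj))).obj (op Y.idObj)]
      (E.pullback (str Y.obj)).obj (op Y.idObj) :=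
  ((PresheafOfModules.evaluation _ (op Y.idObj)).mapIso (φ Y)).toLinearEquiv

/-- The restriction map of functions along `g : Z ⟶ Y`. -/
def sameRingHom {X : Scheme.{u}} {H : Sieve X} {Y Z : (SieveCat H)ᵒᵖ} (g : Y ⟶ Z) :
    (sieveRing (H.pullback (str Y.unop.obj))).obj (op Y.unop.idObj) →+*
      (sieveRing (H.pullback (str Z.unop.obj))).obj (op Z.unop.idObj) :=
  ((sieveRing H).map g).hom

/-- The restriction map `E(g) : E(Y) ⟶ E(Z)`, for `E(Y) = (f^* E)(Y)` and `E(Z) = ((g ≫ f)^* E)(Z)`. -/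
def sameRestrict {X : Scheme.{u}} {H : Sieve X} (E : HPresheaf H) {Y Z : (SieveCat H)ᵒᵖ}
    (g : Y ⟶ Z) :
    (E.pullback (str Y.unop.obj)).obj (op Y.unop.idObj) →ₛₗ[sameRingHom g]
      (E.pullback (str Z.unop.obj)).obj (op Z.unop.idObj) :=
  E.restrictₛₗ ((SieveCat.same H).map g.unop).op

lemma sameRestrict_id {X : Scheme.{u}} {H : Sieve X} (E : HPresheaf H) (Y : (SieveCat H)ᵒᵖ)
    (s : (E.pullback (str Y.unop.obj)).obj (op Y.unop.idObj)) :
    sameRestrict E (𝟙 Y) s = s := by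
  have h : ((SieveCat.same H).map (𝟙 Y : Y ⟶ Y).unop).op = 𝟙 _ :=
    congrArg Quiver.Hom.op ((SieveCat.same H).map_id Y.unop)
  refine (E.congr_map_apply h s).trans ?_
  rw [E.map_id]
  rfl

lemma sameRestrict_comp {X : Scheme.{u}} {H : Sieve X} (E : HPresheaf H)
    {Y Z W : (SieveCat H)ᵒᵖ} (g : Y ⟶ Z) (k : Z ⟶ W)
    (s : (E.pullback (str Y.unop.obj)).obj (op Y.unop.idObj)) :
    sameRestrict E (g ≫ k) s = sameRestrict E k (sameRestrict E g s) := by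
  have h : ((SieveCat.same H).map (g ≫ k).unop).op =
      ((SieveCat.same H).map g.unop).op ≫ ((SieveCat.same H).map k.unop).op :=
    congrArg Quiver.Hom.op ((SieveCat.same H).map_comp k.unop g.unop)
  exact (E.congr_map_apply h s).trans (E.map_comp_apply _ _ _)

/-- The map `φ_{g ≫ f}(Z)⁻¹ ∘ E(g) ∘ φ_f(Y)`, for `g : Z ⟶ Y` over `X`. -/
def standardizeMap {X : Scheme.{u}} {H : Sieve X} {E : HPresheaf H} {n : SieveCat H → ℕ}
    (φ : ∀ Y : SieveCat H,
      free (sieveRing (H.pullback (str Y.obj))) (n Y) ≅ E.pullback (str Y.obj))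
    {Y Z : (SieveCat H)ᵒᵖ} (g : Y ⟶ Z) :
    (free (sieveRing (H.pullback (str Y.unop.obj))) (n Y.unop)).obj (op Y.unop.idObj) →ₛₗ[
      sameRingHom g]
      (free (sieveRing (H.pullback (str Z.unop.obj))) (n Z.unop)).obj (op Z.unop.idObj) :=
  (standardizeEquiv φ Z.unop).symm.toLinearMap.comp
    ((sameRestrict E g).comp (standardizeEquiv φ Y.unop).toLinearMap)

/-- The standardization `S_H^φ E` of an `H`-presheaf `E` with respect to isomorphisms
`φ_f : 𝒪_Y^{n_f} ≅ f^* E`, one for each `f : Y ⟶ X` in `H`: its module of sections over `f` is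
`Γ(Y, 𝒪_Y)^{n_f}`, and its restriction map for `g : Z ⟶ Y` is `φ_{g ≫ f}(Z)⁻¹ ∘ E(g) ∘ φ_f(Y)`. -/
def standardize {X : Scheme.{u}} {H : Sieve X} (E : HPresheaf H) (n : SieveCat H → ℕ)
    (φ : ∀ Y : SieveCat H,
      free (sieveRing (H.pullback (str Y.obj))) (n Y) ≅ E.pullback (str Y.obj)) : HPresheaf H :=
  mkPresheaf (sieveRing H)
    (fun Y => ModuleCat.of ((sieveRing H).obj Y) (Fin (n Y.unop) → (sieveRing H).obj Y))
    (fun g => standardizeMap φ g)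
    (fun Y s =>
      (congrArg (standardizeEquiv φ Y.unop).symm (sameRestrict_id E Y _)).trans
        ((standardizeEquiv φ Y.unop).symm_apply_apply s))
    (fun {Y Z W} g k s => by
      refine congrArg (standardizeEquiv φ W.unop).symm ((sameRestrict_comp E g k _).trans
        (congrArg (sameRestrict E k) ?_))
      exact ((standardizeEquiv φ Z.unop).apply_symm_apply _).symm)

section Extension

open Scheme

variable {X Y Z W : Scheme.{u}}

/-- The module of global sections of a sheaf of modules. -/
def sec (M : Y.Modules) : ModuleCat.{u} (globRing Y) := M.val.obj (op ⊤)

/-- The map on global sections induced by a morphism of sheaves of modules. -/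
def secMap {M N : Y.Modules} (α : M ⟶ N) : sec M →ₗ[globRing Y] sec N := (α.val.app (op ⊤)).hom

lemma secMap_comp {M N P : Y.Modules} (α : M ⟶ N) (β : N ⟶ P) (s : sec M) :
    secMap (α ≫ β) s = secMap β (secMap α s) := rfl

lemma secMap_id {M : Y.Modules} (s : sec M) : secMap (𝟙 M) s = s := rfl

/-- `Γ(Y, g_* N) = Γ(Z, N)`. -/
def secPush (g : Z ⟶ Y) (N : Z.Modules) :
    sec ((Modules.pushforward g).obj N) →ₛₗ[glob g] sec N where
  toFun s := s
  map_add' _ _ := rfl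
  map_smul' _ _ := rfl

lemma secPush_naturality (g : Z ⟶ Y) {M N : Z.Modules} (α : M ⟶ N)
    (s : sec ((Modules.pushforward g).obj M)) :
    secPush g N (secMap ((Modules.pushforward g).map α) s) = secMap α (secPush g M s) := rfl

lemma secPush_comp (g : Z ⟶ Y) (f : Y ⟶ X) (N : Z.Modules)
    (s : sec ((Modules.pushforward f).obj ((Modules.pushforward g).obj N))) :
    secPush (g ≫ f) N (secMap ((Modules.pushforwardComp g f).hom.app N) s) =
      secPush g N (secPush f _ s) := rfl

lemma secPush_id (N : Y.Modules) (s : sec N) :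
    secPush (𝟙 Y) N (secMap ((Modules.pushforwardId Y).inv.app N) s) = s := rfl

/-- Pullback of global sections, `Γ(Y, M) ⟶ Γ(Z, g^* M)`. -/
def pullSec (g : Z ⟶ Y) (M : Y.Modules) : sec M →ₛₗ[glob g] sec ((Modules.pullback g).obj M) :=
  (secPush g ((Modules.pullback g).obj M)).comp
    (secMap ((Modules.pullbackPushforwardAdjunction g).unit.app M))

lemma pullSec_apply (g : Z ⟶ Y) (M : Y.Modules) (s : sec M) :
    pullSec g M s = secPush g ((Modules.pullback g).obj M)
      (secMap ((Modules.pullbackPushforwardAdjunction g).unit.app M) s) := by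
  rw [pullSec, LinearMap.comp_apply]

lemma pullSec_naturality (g : Z ⟶ Y) {M N : Y.Modules} (α : M ⟶ N) (s : sec M) :
    pullSec g N (secMap α s) = secMap ((Modules.pullback g).map α) (pullSec g M s) := by
  have h := (Modules.pullbackPushforwardAdjunction g).unit.naturality α
  rw [pullSec_apply, pullSec_apply, ← secPush_naturality, ← secMap_comp, ← secMap_comp]
  exact congrArg (fun t => secPush g _ (secMap t s)) h

/-- The canonical isomorphism `g^* f^* M ≅ h^* M`, where `h` is the composite of `g` and `f`. -/
def cmp (g : Z ⟶ Y) (f : Y ⟶ X) (h : Z ⟶ X) (w : g ≫ f = h) (M : X.Modules) :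
    (Modules.pullback g).obj ((Modules.pullback f).obj M) ≅ (Modules.pullback h).obj M :=
  (Modules.pullbackComp g f).app M ≪≫ (Modules.pullbackCongr w).app M

lemma cmp_self (g : Z ⟶ Y) (f : Y ⟶ X) (M : X.Modules) :
    cmp g f (g ≫ f) rfl M = (Modules.pullbackComp g f).app M := by
  ext1
  simp [cmp, Modules.pullbackCongr]

lemma cmp_naturality (g : Z ⟶ Y) (f : Y ⟶ X) (h : Z ⟶ X) (w : g ≫ f = h) {M N : X.Modules}
    (α : M ⟶ N) :
    (Modules.pullback g).map ((Modules.pullback f).map α) ≫ (cmp g f h w N).hom =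
      (cmp g f h w M).hom ≫ (Modules.pullback h).map α := by
  subst w
  rw [cmp_self, cmp_self]
  exact (Modules.pullbackComp g f).hom.naturality α

lemma cmp_pullSec (g : Z ⟶ Y) (f : Y ⟶ X) (h : Z ⟶ X) (w : g ≫ f = h) (M : X.Modules)
    (s : sec M) :
    secMap (cmp g f h w M).hom (pullSec g _ (pullSec f M s)) = pullSec h M s := by
  subst w
  rw [cmp_self]
  have h := unit_conjugateEquiv ((Modules.pullbackPushforwardAdjunction f).comp
    (Modules.pullbackPushforwardAdjunction g)) (Modules.pullbackPushforwardAdjunction (g ≫ f))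
    (Modules.pullbackComp g f).inv M
  rw [Modules.conjugateEquiv_pullbackComp_inv, Adjunction.comp_unit_app] at h
  have h' : pullSec g _ (pullSec f M s) =
      secMap ((Modules.pullbackComp g f).inv.app M) (pullSec (g ≫ f) M s) := by
    rw [pullSec_apply g, pullSec_apply f, pullSec_apply (g ≫ f), ← secPush_naturality,
      ← secMap_comp]
    refine Eq.trans ?_ (congrArg (fun t => secPush (g ≫ f) _ (secMap t s)) h)
    refine Eq.trans ?_ (secPush_comp g f _ _)
    exact congrArg (secPush g _) (secPush_naturality f _ _).symm
  rw [h', ← secMap_comp]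
  have h₂ : (Modules.pullbackComp g f).inv.app M ≫ ((Modules.pullbackComp g f).app M).hom = 𝟙 _ :=
    (Modules.pullbackComp g f).inv_hom_id_app M
  rw [h₂, secMap_id]

lemma cmp_assoc (k : W ⟶ Z) (g : Z ⟶ Y) (f : Y ⟶ X) (kg : W ⟶ Y) (gf : Z ⟶ X) (h : W ⟶ X)
    (w₁ : k ≫ g = kg) (w₂ : g ≫ f = gf) (w₃ : kg ≫ f = h) (w₄ : k ≫ gf = h) (M : X.Modules) :
    (Modules.pullback k).map (cmp g f gf w₂ M).hom ≫ (cmp k gf h w₄ M).hom =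
      (cmp k g kg w₁ ((Modules.pullback f).obj M)).hom ≫ (cmp kg f h w₃ M).hom := by
  subst w₁ w₂ w₃
  rw [cmp_self, cmp_self, cmp_self]
  have h := congr(NatTrans.app $(Modules.pseudofunctor_associativity k g f) M)
  simp only [NatTrans.comp_app, Functor.whiskerRight_app, Functor.whiskerLeft_app,
    Functor.associator_hom_app, Category.id_comp, eqToHom_app] at h
  simp only [cmp, Modules.pullbackCongr, Iso.trans_hom, Iso.app_hom, eqToIso.hom, eqToHom_app]
  rw [← h, Iso.hom_inv_id_app_assoc, ← Functor.map_comp_assoc, Iso.hom_inv_id_app]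
  erw [CategoryTheory.Functor.map_id]
  rw [Category.id_comp]

instance (f : Y ⟶ X) : (TopologicalSpace.Opens.map f.base).Final where
  out U := by
    have : Nonempty (StructuredArrow U (TopologicalSpace.Opens.map f.base)) :=
      ⟨StructuredArrow.mk (Y := ⊤) (homOfLE le_top)⟩
    refine zigzag_isConnected fun a b => ?_
    let t : StructuredArrow U (TopologicalSpace.Opens.map f.base) :=
      StructuredArrow.mk (Y := ⊤) (homOfLE le_top)
    have h (c : StructuredArrow U (TopologicalSpace.Opens.map f.base)) : Nonempty (c ⟶ t) :=
      ⟨StructuredArrow.homMk (homOfLE le_top) (Subsingleton.elim _ _)⟩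
    exact (Zigzag.of_hom (h a).some).trans (Zigzag.of_inv (h b).some)

/-- The structure sheaf as a sheaf of modules. -/
abbrev oMod (X : Scheme.{u}) : X.Modules := SheafOfModules.unit X.ringCatSheaf

theorem pushforward_isRightAdjoint (f : Y ⟶ X) :
    (SheafOfModules.pushforward.{u} f.toRingCatSheafHom).IsRightAdjoint :=
  (inferInstance : (Modules.pushforward f).IsRightAdjoint)

/-- The canonical map `𝒪_X ⟶ f_* 𝒪_Y`. -/
def unitToPush (f : Y ⟶ X) : oMod X ⟶ (Modules.pushforward f).obj (oMod Y) :=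
  SheafOfModules.unitToPushforwardObjUnit f.toRingCatSheafHom

/-- The canonical map `f^* 𝒪_X ⟶ 𝒪_Y`. -/
def unitHom (f : Y ⟶ X) : (Modules.pullback f).obj (oMod X) ⟶ oMod Y :=
  ((Modules.pullbackPushforwardAdjunction f).homEquiv _ _).symm (unitToPush f)

instance (f : Y ⟶ X) : IsIso (unitHom f) := by
  have := pushforward_isRightAdjoint f
  exact SheafOfModules.instIsIsoPullbackObjUnitToUnitOfFinal f.toRingCatSheafHom

/-- The canonical isomorphism `f^* 𝒪_X ≅ 𝒪_Y`. -/
def unitIso (f : Y ⟶ X) : (Modules.pullback f).obj (oMod X) ≅ oMod Y :=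
  asIso (unitHom f)

/-- `Γ(X, 𝒪_X)` as the module of global sections of `𝒪_X`. -/
def secUnit (X : Scheme.{u}) : globRing X ≃ₗ[globRing X] sec (oMod X) where
  toFun s := s
  invFun s := s
  map_add' _ _ := rfl
  map_smul' _ _ := rfl
  left_inv _ := rfl
  right_inv _ := rfl

lemma secPush_unitToPush (f : Y ⟶ X) (a : globRing X) :
    secPush f _ (secMap (unitToPush f) (secUnit X a)) = secUnit Y (glob f a) := rfl

lemma unitIso_pullSec (f : Y ⟶ X) (a : globRing X) :
    secMap (unitIso f).hom (pullSec f (oMod X) (secUnit X a)) = secUnit Y (glob f a) := by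
  have h := (Modules.pullbackPushforwardAdjunction f).homEquiv_unit (X := oMod X)
    (f := unitHom f)
  rw [unitHom, Equiv.apply_symm_apply] at h
  rw [pullSec_apply, ← secPush_naturality, ← secMap_comp, ← secPush_unitToPush]
  exact congrArg (fun t => secPush f _ (secMap t (secUnit X a))) h.symm

lemma oMod_hom_ext {M : X.Modules} (α β : oMod X ⟶ M)
    (e : secMap α (secUnit X 1) = secMap β (secUnit X 1)) : α = β := by
  have hres (γ : oMod X ⟶ M) (U : X.Opens) (a : Γ(X, U)) : γ.app U a =
      (M.smul a).hom (M.presheaf.map (homOfLE (le_top : U ≤ ⊤)).op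
        (secMap γ (secUnit X 1) : sec M)) := by
    have h₁ := γ.app_smul (U := U) a (1 : Γ(X, U))
    have h₂ := congr($(γ.mapPresheaf.naturality (homOfLE (le_top : U ≤ ⊤)).op) (1 : Γ(X, ⊤)))
    have h₃ : (oMod X).presheaf.map (homOfLE (le_top : U ≤ ⊤)).op (1 : Γ(X, ⊤)) = (1 : Γ(X, U)) :=
      map_one (X.presheaf.map (homOfLE (le_top : U ≤ ⊤)).op).hom
    have h₄ : ((oMod X).smul a).hom (1 : Γ(X, U)) = a := mul_one a
    exact ((congrArg (γ.app U) h₄).symm.trans h₁).trans (congrArg (M.smul a).hom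
      ((congrArg (γ.app U) h₃).symm.trans h₂))
  ext U a
  exact (hres α U a).trans ((congrArg (fun t : sec M => (M.smul a).hom
    (M.presheaf.map (homOfLE (le_top : U ≤ ⊤)).op t)) e).trans (hres β U a).symm)

lemma unit_hom_ext {h : Y ⟶ X} {N : Y.Modules} (φ ψ : (Modules.pullback h).obj (oMod X) ⟶ N)
    (e : secMap φ (pullSec h (oMod X) (secUnit X 1)) =
      secMap ψ (pullSec h (oMod X) (secUnit X 1))) :
    φ = ψ := by
  apply ((Modules.pullbackPushforwardAdjunction h).homEquiv _ _).injective
  rw [Adjunction.homEquiv_unit, Adjunction.homEquiv_unit]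
  apply oMod_hom_ext
  rw [pullSec_apply, ← secPush_naturality, ← secPush_naturality, ← secMap_comp, ← secMap_comp] at e
  exact e

lemma unitIso_pullSec_one (f : Y ⟶ X) :
    secMap (unitIso f).hom (pullSec f (oMod X) (secUnit X 1)) = secUnit Y 1 := by
  rw [unitIso_pullSec, map_one]

lemma unitIso_cmp (g : Z ⟶ Y) (f : Y ⟶ X) (h : Z ⟶ X) (w : g ≫ f = h) :
    (cmp g f h w (oMod X)).hom ≫ (unitIso h).hom =
      (Modules.pullback g).map (unitIso f).hom ≫ (unitIso g).hom := by
  rw [← Iso.eq_inv_comp]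
  apply unit_hom_ext
  rw [unitIso_pullSec_one, ← cmp_pullSec g f h w, ← secMap_comp, Iso.hom_inv_id_assoc, secMap_comp,
    ← pullSec_naturality, unitIso_pullSec_one, unitIso_pullSec_one]

/-- The map `Γ(Y, f^* M) ⟶ Γ(Z, g^* f^* M) ≅ Γ(Z, h^* M)`, where `h` is the composite of `g` and `f`. -/
def bigPull (g : Z ⟶ Y) (f : Y ⟶ X) (h : Z ⟶ X) (w : g ≫ f = h) (M : X.Modules) :
    sec ((Modules.pullback f).obj M) →ₛₗ[glob g] sec ((Modules.pullback h).obj M) :=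
  (secMap (cmp g f h w M).hom).comp (pullSec g ((Modules.pullback f).obj M))

lemma bigPull_apply (g : Z ⟶ Y) (f : Y ⟶ X) (h : Z ⟶ X) (w : g ≫ f = h) (M : X.Modules)
    (s : sec ((Modules.pullback f).obj M)) :
    bigPull g f h w M s =
      secMap (cmp g f h w M).hom (pullSec g ((Modules.pullback f).obj M) s) := by
  rw [bigPull, LinearMap.comp_apply]

lemma cmp_bigPull_apply (k : W ⟶ Z) (g : Z ⟶ Y) (f : Y ⟶ X) (kg : W ⟶ Y) (gf : Z ⟶ X) (h : W ⟶ X)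
    (w₁ : k ≫ g = kg) (w₂ : g ≫ f = gf) (w₃ : kg ≫ f = h) (w₄ : k ≫ gf = h) (M : X.Modules)
    (s : sec ((Modules.pullback g).obj ((Modules.pullback f).obj M))) :
    secMap (cmp kg f h w₃ M).hom (bigPull k g kg w₁ _ s) =
      bigPull k gf h w₄ M (secMap (cmp g f gf w₂ M).hom s) := by
  rw [bigPull_apply, bigPull_apply, pullSec_naturality, ← secMap_comp, ← secMap_comp,
    cmp_assoc k g f kg gf h w₁ w₂ w₃ w₄]

lemma bigPull_comp (k : W ⟶ Z) (g : Z ⟶ Y) (f : Y ⟶ X) (kg : W ⟶ Y) (gf : Z ⟶ X) (h : W ⟶ X)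
    (w₁ : k ≫ g = kg) (w₂ : g ≫ f = gf) (w₃ : kg ≫ f = h) (w₄ : k ≫ gf = h) (M : X.Modules) :
    ActsAsComp (bigPull g f gf w₂ M) (bigPull k gf h w₄ M) (bigPull kg f h w₃ M) := by
  intro s
  rw [bigPull_apply g f gf, ← cmp_bigPull_apply k g f kg gf h w₁ w₂ w₃ w₄, bigPull_apply, bigPull_apply,
    cmp_pullSec]

lemma bigPull_id (f : Y ⟶ X) (M : X.Modules) (s : sec ((Modules.pullback f).obj M)) :
    bigPull (𝟙 Y) f f (Category.id_comp f) M s = s := by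
  have h₁ : (cmp (𝟙 Y) f f (Category.id_comp f) M).hom =
      (Modules.pullbackId Y).hom.app ((Modules.pullback f).obj M) := by
    have h := congr(NatTrans.app $(Modules.pseudofunctor_right_unitality f) M)
    simp only [NatTrans.comp_app, Functor.whiskerLeft_app, Functor.rightUnitor_hom_app,
      eqToHom_app] at h
    simp only [cmp, Modules.pullbackCongr, Iso.trans_hom, Iso.app_hom, eqToIso.hom, eqToHom_app]
    rw [← h, Iso.hom_inv_id_app_assoc]
    exact Category.comp_id _
  have h₂ := unit_conjugateEquiv Adjunction.id (Modules.pullbackPushforwardAdjunction (𝟙 Y))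
    (Modules.pullbackId Y).hom ((Modules.pullback f).obj M)
  rw [Modules.conjugateEquiv_pullbackId_hom] at h₂
  rw [bigPull_apply, h₁]
  rw [pullSec_apply, ← secPush_naturality, ← secMap_comp]
  refine Eq.trans ?_ (secPush_id _ s)
  exact congrArg (fun t => secPush (𝟙 Y) _ (secMap t s)) h₂.symm

lemma bigPull_id' (g : Y ⟶ Y) (hg : g = 𝟙 Y) (f : Y ⟶ X) (w : g ≫ f = f) (M : X.Modules) :
    ActsAsId (bigPull g f f w M) := by
  subst hg
  exact bigPull_id f M

/-- An isomorphism of sheaves of modules induces one on global sections. -/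
def secIso {M N : Y.Modules} (α : M ≅ N) : sec M ≃ₗ[globRing Y] sec N :=
  LinearEquiv.ofLinearMap (secMap α.hom) (secMap α.inv)
    (by ext s; exact (secMap_comp α.inv α.hom s).symm.trans (by rw [Iso.inv_hom_id]; rfl))
    (by ext s; exact (secMap_comp α.hom α.inv s).symm.trans (by rw [Iso.hom_inv_id]; rfl))

lemma secIso_apply {M N : Y.Modules} (α : M ≅ N) (s : sec M) :
    secIso α s = secMap α.hom s := rfl

lemma bigPull_naturality (g : Z ⟶ Y) (f : Y ⟶ X) (h : Z ⟶ X) (w : g ≫ f = h) {M N : X.Modules}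
    (α : M ≅ N) :
    Intertwines (bigPull g f h w M) (bigPull g f h w N) (secIso ((Modules.pullback f).mapIso α))
      (secIso ((Modules.pullback h).mapIso α)) := by
  intro s
  rw [secIso_apply, secIso_apply, bigPull_apply, bigPull_apply, Functor.mapIso_hom,
    Functor.mapIso_hom, pullSec_naturality, ← secMap_comp, ← secMap_comp, cmp_naturality]

lemma unitIso_bigPull (g : Z ⟶ Y) (f : Y ⟶ X) (h : Z ⟶ X) (w : g ≫ f = h) :
    IntertwinesRing (bigPull g f h w (oMod X)) ((secIso (unitIso f)).trans (secUnit Y).symm)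
      ((secIso (unitIso h)).trans (secUnit Z).symm) := by
  intro s
  rw [LinearEquiv.trans_apply, LinearEquiv.trans_apply, secIso_apply, secIso_apply, bigPull_apply,
    ← secMap_comp, unitIso_cmp, secMap_comp, ← pullSec_naturality,
    LinearEquiv.symm_apply_eq, ← unitIso_pullSec, LinearEquiv.apply_symm_apply]

lemma cmp_bigPull (k : W ⟶ Z) (g : Z ⟶ Y) (f : Y ⟶ X) (kg : W ⟶ Y) (gf : Z ⟶ X) (h : W ⟶ X)
    (w₁ : k ≫ g = kg) (w₂ : g ≫ f = gf) (w₃ : kg ≫ f = h) (w₄ : k ≫ gf = h) (M : X.Modules) :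
    Intertwines (bigPull k g kg w₁ ((Modules.pullback f).obj M)) (bigPull k gf h w₄ M)
      (secIso (cmp g f gf w₂ M)) (secIso (cmp kg f h w₃ M)) := by
  intro s
  rw [secIso_apply, secIso_apply]
  exact cmp_bigPull_apply k g f kg gf h w₁ w₂ w₃ w₄ M s

end Extension

section

variable {X : Scheme.{u}}

/-- The data of a presheaf of modules on the category of schemes over `X`. -/
structure BigData (X : Scheme.{u}) where
  obj (Y : Over X) : ModuleCat.{u} (globRing Y.left)
  res (Y Z : Over X) (g : Z ⟶ Y) : obj Y →ₛₗ[glob g.left] obj Z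
  res_id (Y : Over X) : ActsAsId (res Y Y (𝟙 Y))
  res_comp (Y Z W : Over X) (g : Z ⟶ Y) (k : W ⟶ Z) :
    ActsAsComp (res Y Z g) (res Z W k) (res Y W (k ≫ g))

/-- The presheaf of modules with the given data. -/
def BigData.toBig (D : BigData X) : BigPresheaf X :=
  mkPresheaf (bigRing X) (fun Y => D.obj Y.unop) (fun g => D.res _ _ g.unop)
    (fun Y => D.res_id Y.unop) (fun g k => D.res_comp _ _ _ g.unop k.unop)

/-- An isomorphism of presheaves of modules from isomorphisms of the modules of sections. -/
def BigData.iso {D E : BigData X} (e : ∀ Y : Over X, D.obj Y ≃ₗ[globRing Y.left] E.obj Y)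
    (he : ∀ (Y Z : Over X) (g : Z ⟶ Y), Intertwines (D.res Y Z g) (E.res Y Z g) (e Y) (e Z)) :
    D.toBig ≅ E.toBig :=
  mkIso (fun Y => e Y.unop) (fun g => he _ _ g.unop)

/-- An isomorphism from `𝒪` to a presheaf of modules, from isomorphisms of the modules of sections. -/
def BigData.freeIso {D : BigData X} (e : ∀ Y : Over X, D.obj Y ≃ₗ[globRing Y.left] globRing Y.left)
    (he : ∀ (Y Z : Over X) (g : Z ⟶ Y), IntertwinesRing (D.res Y Z g) (e Y) (e Z)) :
    free (bigRing X) 1 ≅ D.toBig :=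
  (mkIso (M := D.toBig) (N := free (bigRing X) 1)
    (fun Y => toFinOne (e Y.unop))
    (fun g s => by funext i; exact he _ _ g.unop s)).symm

/-- The data of the presheaf of modules `B M`. -/
def bigData (M : X.Modules) : BigData X where
  obj Y := sec ((Scheme.Modules.pullback (str Y)).obj M)
  res Y Z g := bigPull g.left (str Y) (str Z) (str_w g) M
  res_id Y := bigPull_id' _ (Over.id_left Y) (str Y) (str_w (𝟙 Y)) M
  res_comp Y Z W g k := bigPull_comp k.left g.left (str Y) _ (str Z) (str W)
      (Over.comp_left _ _ _ k g).symm (str_w g) (str_w (k ≫ g)) (str_w k) M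

/-- The extension `B M` of a sheaf of modules `M` on `X` to the category of schemes over `X`: its
sections over `f : Y ⟶ X` are `Γ(Y, f^* M)`, and its restriction map for `g : Z ⟶ Y` over `X` is
`Γ(Y, f^* M) ⟶ Γ(Z, g^* f^* M) ≅ Γ(Z, (g ≫ f)^* M)`. -/
def bigExt (M : X.Modules) : BigPresheaf X := (bigData M).toBig

/-- The isomorphism `B α : B M ≅ B N` induced by `α : M ≅ N`. -/
def bigExtMapIso {M N : X.Modules} (α : M ≅ N) : bigExt M ≅ bigExt N :=
  BigData.iso (D := bigData M) (E := bigData N)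
    (fun Y => secIso ((Scheme.Modules.pullback (str Y)).mapIso α))
    (fun Y Z g => bigPull_naturality g.left (str Y) (str Z) (str_w g) α)

/-- The canonical isomorphism from the presheaf `𝒪` on the category of schemes over `X` to `B 𝒪_X`. -/
def bigExtUnit (X : Scheme.{u}) : free (bigRing X) 1 ≅ bigExt (oMod X) :=
  BigData.freeIso (D := bigData (oMod X))
    (fun Y => (secIso (unitIso (str Y))).trans (secUnit Y.left).symm)
    (fun Y Z g => unitIso_bigPull g.left (str Y) (str Z) (str_w g))

/-- An isomorphism `E|_{f^* H} ≅ f^*(D|_H)` from isomorphisms of the modules of sections. -/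
def BigData.resIso {Y : Scheme.{u}} {D : BigData X} {E : BigData Y} (f : Y ⟶ X) (H : Sieve X)
    (e : ∀ Z : Over Y, E.obj Z ≃ₗ[globRing Z.left] D.obj ((Over.map f).obj Z))
    (he : ∀ (Z W : Over Y) (g : W ⟶ Z),
      Intertwines (E.res Z W g) (D.res _ _ ((Over.map f).map g)) (e Z) (e W)) :
    E.toBig.restrict (H.pullback f) ≅ (D.toBig.restrict H).pullback f :=
  mkIso (M := E.toBig.restrict (H.pullback f)) (N := (D.toBig.restrict H).pullback f)
    (fun Y => e Y.unop.obj) (fun g => he _ _ g.unop.hom)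

/-- The canonical isomorphism `B(f^* M)|_{f^* H} ≅ f^*(B M|_H)`, given over `k : Z ⟶ Y` by
`Γ(Z, k^* f^* M) ≅ Γ(Z, (k ≫ f)^* M)`. -/
def bigExtResIso {Y : Scheme.{u}} (f : Y ⟶ X) (H : Sieve X) (M : X.Modules) :
    (bigExt ((Scheme.Modules.pullback f).obj M)).restrict (H.pullback f) ≅
      ((bigExt M).restrict H).pullback f :=
  BigData.resIso (D := bigData M) (E := bigData ((Scheme.Modules.pullback f).obj M)) f H
    (fun Z => secIso (cmp (str Z) f (str ((Over.map f).obj Z)) rfl M))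
    (fun Z W g => cmp_bigPull g.left (str Z) f (str W) (str ((Over.map f).obj Z))
      (str ((Over.map f).obj W)) (str_w g) rfl rfl (str_w ((Over.map f).map g)) M)

end

section Twist

open TopologicalSpace

variable {A σ : Type u} [CommRing A] [SetLike σ A] [AddSubgroupClass σ A]
variable {𝒜 : ℕ → σ} [GradedRing 𝒜]

/-- The elements outside of the homogeneous prime ideal corresponding to a point. -/
abbrev denAt (x : ProjectiveSpectrum 𝒜) : Submonoid A := x.asHomogeneousIdeal.toIdeal.primeCompl

/-- The localization of `A` at the homogeneous prime ideal corresponding to a point. -/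
abbrev LocAt (x : ProjectiveSpectrum 𝒜) : Type u := Localization (denAt x)

/-- The family `f` is given by one fraction `r / s` with `r`, `s` homogeneous and
`deg r - deg s = n`. -/
def IsTwistedFraction (n : ℤ) {U : Opens (ProjectiveSpectrum.top 𝒜)}
    (f : ∀ x : U, LocAt (𝒜 := 𝒜) x.1) : Prop :=
  ∃ (i j : ℕ) (r s : A), r ∈ 𝒜 i ∧ s ∈ 𝒜 j ∧ (i : ℤ) - j = n ∧
    ∀ x : U, ∃ hs : s ∈ denAt (𝒜 := 𝒜) x.1, f x = Localization.mk r ⟨s, hs⟩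

variable (𝒜) in
/-- The family is locally given by fractions `r / s` with `r`, `s` homogeneous and
`deg r - deg s = n`. -/
def isLocallyTwistedFraction (n : ℤ) :
    TopCat.LocalPredicate (fun x : ProjectiveSpectrum.top 𝒜 => LocAt (𝒜 := 𝒜) x) :=
  TopCat.PrelocalPredicate.sheafify
    { pred := fun f => IsTwistedFraction n f
      res := by
        rintro V U i f ⟨a, b, r, s, hr, hs, hd, h⟩
        exact ⟨a, b, r, s, hr, hs, hd, fun x => h (i x)⟩ }

lemma exists_homogeneous (x : ProjectiveSpectrum 𝒜) (m : ℕ) :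
    ∃ d ≥ m, ∃ t ∈ 𝒜 d, t ∈ denAt x := by
  have h := x.not_irrelevant_le
  rw [HomogeneousIdeal.irrelevant_le] at h
  push Not at h
  obtain ⟨i, hi, h⟩ := h
  obtain ⟨t, ht, htx⟩ := Set.not_subset.mp h
  replace ht : t ∈ 𝒜 i := ht
  exact ⟨m * i, Nat.le_mul_of_pos_right m hi, t ^ m, by
    simpa using SetLike.pow_mem_graded m ht, pow_mem (S := denAt x) htx m⟩

lemma twist_zero_mem (n : ℤ) (U : Opens (ProjectiveSpectrum.top 𝒜)) :
    (isLocallyTwistedFraction 𝒜 n).pred (fun x : U => (0 : LocAt (𝒜 := 𝒜) x.1)) := by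
  intro x
  obtain ⟨d, hd, t, ht, htx⟩ := exists_homogeneous (𝒜 := 𝒜) x.1 n.natAbs
  refine ⟨U ⊓ ProjectiveSpectrum.basicOpen 𝒜 t, ⟨x.2, htx⟩, Opens.infLELeft _ _,
    (n + d).toNat, d, 0, t, zero_mem _, ht, by omega, fun y => ⟨y.2.2, ?_⟩⟩
  exact (Localization.mk_zero _).symm

lemma twist_add_mem {n : ℤ} {U : Opens (ProjectiveSpectrum.top 𝒜)}
    {f g : ∀ x : U, LocAt (𝒜 := 𝒜) x.1} (hf : (isLocallyTwistedFraction 𝒜 n).pred f)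
    (hg : (isLocallyTwistedFraction 𝒜 n).pred g) :
    (isLocallyTwistedFraction 𝒜 n).pred (fun x => f x + g x) := by
  intro x
  obtain ⟨V, hV, iV, a, b, r, s, hr, hs, hd, hf⟩ := hf x
  obtain ⟨V', hV', iV', a', b', r', s', hr', hs', hd', hg⟩ := hg x
  refine ⟨V ⊓ V', ⟨hV, hV'⟩, Opens.infLELeft _ _ ≫ iV, b + a', b + b', s * r' + s' * r, s * s',
    add_mem (SetLike.mul_mem_graded hs hr') ?_, SetLike.mul_mem_graded hs hs', by omega,
    fun y => ?_⟩
  · have h := SetLike.mul_mem_graded hs' hr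
    rwa [show b' + a = b + a' by omega] at h
  · obtain ⟨h₁, e₁⟩ := hf ⟨y.1, y.2.1⟩
    obtain ⟨h₂, e₂⟩ := hg ⟨y.1, y.2.2⟩
    refine ⟨mul_mem h₁ h₂, ?_⟩
    exact (congrArg₂ (· + ·) e₁ e₂).trans (Localization.add_mk _ _ _ _)

lemma twist_neg_mem {n : ℤ} {U : Opens (ProjectiveSpectrum.top 𝒜)}
    {f : ∀ x : U, LocAt (𝒜 := 𝒜) x.1} (hf : (isLocallyTwistedFraction 𝒜 n).pred f) :
    (isLocallyTwistedFraction 𝒜 n).pred (fun x => - f x) := by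
  intro x
  obtain ⟨V, hV, iV, a, b, r, s, hr, hs, hd, hf⟩ := hf x
  refine ⟨V, hV, iV, a, b, -r, s, neg_mem hr, hs, hd, fun y => ?_⟩
  obtain ⟨h₁, e₁⟩ := hf y
  exact ⟨h₁, (congrArg Neg.neg e₁).trans (Localization.neg_mk _ _)⟩

lemma twist_smul_mem {n : ℤ} {U : Opens (ProjectiveSpectrum.top 𝒜)}
    {c : ∀ x : U, HomogeneousLocalization 𝒜 (denAt (𝒜 := 𝒜) x.1)}
    (hc : (ProjectiveSpectrum.StructureSheaf.isLocallyFraction 𝒜).pred c)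
    {f : ∀ x : U, LocAt (𝒜 := 𝒜) x.1} (hf : (isLocallyTwistedFraction 𝒜 n).pred f) :
    (isLocallyTwistedFraction 𝒜 n).pred (fun x => (c x).val * f x) := by
  intro x
  obtain ⟨V, hV, iV, a, b, r, s, hr, hs, hd, hf⟩ := hf x
  obtain ⟨V', hV', iV', j, ⟨p, hp⟩, ⟨q, hq⟩, hq', hc⟩ := hc x
  refine ⟨V ⊓ V', ⟨hV, hV'⟩, Opens.infLELeft _ _ ≫ iV, j + a, j + b, p * r, q * s,
    SetLike.mul_mem_graded hp hr, SetLike.mul_mem_graded hq hs, by push_cast; omega, fun y => ?_⟩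
  obtain ⟨h₁, e₁⟩ := hf ⟨y.1, y.2.1⟩
  have e₂ := congrArg HomogeneousLocalization.val (hc ⟨y.1, y.2.2⟩)
  rw [HomogeneousLocalization.val_mk] at e₂
  refine ⟨mul_mem (hq' ⟨y.1, y.2.2⟩) h₁, ?_⟩
  exact (congrArg₂ (· * ·) e₂ e₁).trans (Localization.mk_mul _ _ _ _)

variable (𝒜) in
/-- The group of sections of Serre's sheaf `𝒪(n)` over an open subset `U` of `Proj 𝒜`: the families of
elements of the localizations at the points of `U` which are locally fractions of degree `n`. -/
def twistSections (n : ℤ) (U : Opens (ProjectiveSpectrum.top 𝒜)) :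
    AddSubgroup (∀ x : U, LocAt (𝒜 := 𝒜) x.1) where
  carrier := {f | (isLocallyTwistedFraction 𝒜 n).pred f}
  zero_mem' := twist_zero_mem n U
  add_mem' := twist_add_mem
  neg_mem' := twist_neg_mem

/-- The value of a regular function on `Proj 𝒜` at a point, as an element of the localization. -/
def valAt {U : (Proj 𝒜).Opens} (c : Γ(Proj 𝒜, U)) (x : U) : LocAt (𝒜 := 𝒜) x.1 :=
  (c.1 x).val

instance twistModule (n : ℤ) (U : (Proj 𝒜).Opens) :
    Module Γ(Proj 𝒜, U) (twistSections 𝒜 n U) where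
  smul c f := ⟨fun x => valAt c x * f.1 x, twist_smul_mem c.2 f.2⟩
  one_smul f := by
    refine Subtype.ext (funext fun x => ?_)
    exact (congrArg (· * f.1 x) HomogeneousLocalization.val_one).trans (one_mul _)
  mul_smul a b f := by
    refine Subtype.ext (funext fun x => ?_)
    exact (congrArg (· * f.1 x) (HomogeneousLocalization.val_mul _ _)).trans (mul_assoc _ _ _)
  smul_zero a := Subtype.ext (funext fun x => mul_zero _)
  smul_add a f g := Subtype.ext (funext fun x => mul_add _ _ _)
  add_smul a b f := by
    refine Subtype.ext (funext fun x => ?_)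
    exact (congrArg (· * f.1 x) (HomogeneousLocalization.val_add _ _)).trans (add_mul _ _ _)
  zero_smul f := by
    refine Subtype.ext (funext fun x => ?_)
    exact (congrArg (· * f.1 x) HomogeneousLocalization.val_zero).trans (zero_mul _)

/-- Restriction of sections of `𝒪(n)`. -/
def twistRes (n : ℤ) {U V : (Proj 𝒜).Opens} (i : V ⟶ U) :
    twistSections 𝒜 n U →ₛₗ[((Proj 𝒜).presheaf.map i.op).hom] twistSections 𝒜 n V where
  toFun f := ⟨fun x => f.1 (i x), (isLocallyTwistedFraction 𝒜 n).res i f.1 f.2⟩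
  map_add' _ _ := rfl
  map_smul' _ _ := rfl

variable (𝒜) in
/-- The presheaf of modules `𝒪(n)` on `Proj 𝒜`. -/
def twistPresheaf (n : ℤ) : (Proj 𝒜).PresheafOfModules :=
  mkPresheaf (Proj 𝒜).ringCatSheaf.obj (fun U => ModuleCat.of Γ(Proj 𝒜, U.unop) (twistSections 𝒜 n U.unop))
    (fun g => twistRes n g.unop) (fun _ _ => rfl) (fun _ _ _ => rfl)

lemma twistPresheaf_isSheaf (n : ℤ) :
    TopCat.Presheaf.IsSheaf (X := ProjectiveSpectrum.top 𝒜) (twistPresheaf 𝒜 n).presheaf := by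
  refine (TopCat.Presheaf.isSheaf_iff_isSheaf_comp (forget Ab) _).mpr ?_
  exact TopCat.Presheaf.isSheaf_of_iso (NatIso.ofComponents (fun _ => Iso.refl _) (fun _ => rfl))
    (TopCat.subsheafToTypes (isLocallyTwistedFraction 𝒜 n)).property

variable (𝒜) in
/-- Serre's twisting sheaf `𝒪(n)` on `Proj 𝒜`. -/
def twist (n : ℤ) : (Proj 𝒜).Modules where
  val := twistPresheaf 𝒜 n
  isSheaf := twistPresheaf_isSheaf n

/-- The element `t ^ n` of the localization at `x`, for an integer `n` and an element `t` that is
invertible there. -/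
def tpow (t : A) (n : ℤ) {x : ProjectiveSpectrum 𝒜} (hx : t ∈ denAt x) : LocAt x :=
  Localization.mk (t ^ n.toNat) ⟨t ^ (-n).toNat, pow_mem hx _⟩

lemma tpow_mul_tpow_neg (t : A) (n : ℤ) {x : ProjectiveSpectrum 𝒜} (hx : t ∈ denAt x) :
    tpow t n hx * tpow t (-n) hx = 1 := by
  rw [tpow, tpow, Localization.mk_mul]
  refine Eq.trans (congrArg₂ Localization.mk (mul_comm _ _) (Subtype.ext ?_))
    (Localization.mk_self (S := denAt x)
      ⟨t ^ (-n).toNat * t ^ n.toNat, mul_mem (pow_mem hx _) (pow_mem hx _)⟩)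
  change t ^ (-n).toNat * t ^ (- -n).toNat = _
  rw [neg_neg]

lemma tpow_mul_cancel (t : A) (n : ℤ) {x : ProjectiveSpectrum 𝒜} (hx : t ∈ denAt x)
    (a : LocAt x) : tpow t n hx * (tpow t (-n) hx * a) = a := by
  rw [← mul_assoc, tpow_mul_tpow_neg, one_mul]

lemma tpow_neg_mul_cancel (t : A) (n : ℤ) {x : ProjectiveSpectrum 𝒜} (hx : t ∈ denAt x)
    (a : LocAt x) : tpow t (-n) hx * (tpow t n hx * a) = a := by
  rw [← mul_assoc, mul_comm (tpow t (-n) hx), tpow_mul_tpow_neg, one_mul]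

lemma mem_denAt {t : A} {U : (Proj 𝒜).Opens} (hU : U ≤ Proj.basicOpen 𝒜 t) (x : U) :
    t ∈ denAt (𝒜 := 𝒜) x.1 := hU x.2

lemma tpow_mul_mem {t : A} (ht : t ∈ 𝒜 1) (n : ℤ) {U : (Proj 𝒜).Opens}
    (hU : U ≤ Proj.basicOpen 𝒜 t) (c : Γ(Proj 𝒜, U)) :
    (isLocallyTwistedFraction 𝒜 n).pred
      (fun x : U => tpow t n (mem_denAt hU x) * valAt c x) := by
  intro x
  obtain ⟨V, hV, iV, j, ⟨p, hp⟩, ⟨q, hq⟩, hq', hc⟩ := c.2 x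
  have h (k : ℕ) : t ^ k ∈ 𝒜 k := by
    have h := SetLike.pow_mem_graded k ht
    rwa [smul_eq_mul, mul_one] at h
  refine ⟨V, hV, iV, n.toNat + j, (-n).toNat + j, t ^ n.toNat * p, t ^ (-n).toNat * q,
    SetLike.mul_mem_graded (h _) hp, SetLike.mul_mem_graded (h _) hq, by omega, fun y => ?_⟩
  have e := congrArg HomogeneousLocalization.val (hc y)
  rw [HomogeneousLocalization.val_mk] at e
  refine ⟨mul_mem (pow_mem (mem_denAt hU (iV y)) _) (hq' y), ?_⟩
  exact (congrArg (tpow t n (mem_denAt hU (iV y)) * ·) e).trans (Localization.mk_mul _ _ _ _)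

/-- Multiplication with `t ^ n` as a map from regular functions to sections of `𝒪(n)`, over an open subset
of `D₊(t)`, for `t` of degree `1`. -/
def mulTpow {t : A} (ht : t ∈ 𝒜 1) (n : ℤ) {U : (Proj 𝒜).Opens}
    (hU : U ≤ Proj.basicOpen 𝒜 t) : Γ(Proj 𝒜, U) →ₗ[Γ(Proj 𝒜, U)] twistSections 𝒜 n U where
  toFun c := ⟨fun x => tpow t n (mem_denAt hU x) * valAt c x, tpow_mul_mem ht n hU c⟩
  map_add' a b := by
    refine Subtype.ext (funext fun x => ?_)
    exact (congrArg (tpow t n (mem_denAt hU x) * ·) (HomogeneousLocalization.val_add _ _)).trans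
      (mul_add _ _ _)
  map_smul' a b := by
    refine Subtype.ext (funext fun x => ?_)
    exact (congrArg (tpow t n (mem_denAt hU x) * ·) (HomogeneousLocalization.val_mul _ _)).trans
      (mul_left_comm _ _ _)

lemma mulTpow_injective {t : A} (ht : t ∈ 𝒜 1) (n : ℤ) {U : (Proj 𝒜).Opens}
    (hU : U ≤ Proj.basicOpen 𝒜 t) : Function.Injective (mulTpow ht n hU) := by
  intro a b h
  refine Subtype.ext (funext fun x => HomogeneousLocalization.val_injective _ ?_)
  have e : tpow t n (mem_denAt hU x) * valAt a x = tpow t n (mem_denAt hU x) * valAt b x :=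
    congrFun (congrArg Subtype.val h) x
  exact (tpow_neg_mul_cancel t n _ _).symm.trans
    ((congrArg (tpow t (-n) (mem_denAt hU x) * ·) e).trans (tpow_neg_mul_cancel t n _ _))

lemma mulTpow_surjective {t : A} (ht : t ∈ 𝒜 1) (n : ℤ) {U : (Proj 𝒜).Opens}
    (hU : U ≤ Proj.basicOpen 𝒜 t) : Function.Surjective (mulTpow ht n hU) := by
  intro f
  have key (x : U) : ∃ (V : (Proj 𝒜).Opens) (_ : x.1 ∈ V) (i : V ≤ U) (k : ℕ) (p q : 𝒜 k)
      (hq : ∀ y : V, q.1 ∈ denAt (𝒜 := 𝒜) y.1), ∀ y : V,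
        (HomogeneousLocalization.mk ⟨k, p, q, hq y⟩ :
          HomogeneousLocalization 𝒜 (denAt (𝒜 := 𝒜) y.1)).val =
        tpow t (-n) (mem_denAt hU ⟨y.1, i y.2⟩) * f.1 ⟨y.1, i y.2⟩ := by
    obtain ⟨V, hV, iV, a, b, r, s, hr, hs, hd, hf⟩ := f.2 x
    have h (k : ℕ) : t ^ k ∈ 𝒜 k := by
      have h := SetLike.pow_mem_graded k ht
      rwa [smul_eq_mul, mul_one] at h
    have h₁ := SetLike.mul_mem_graded (h (-n).toNat) hr
    have h₂ := SetLike.mul_mem_graded (h (- -n).toNat) hs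
    rw [show (- -n).toNat + b = (-n).toNat + a by omega] at h₂
    have hq (y : V) : t ^ (- -n).toNat * s ∈ denAt (𝒜 := 𝒜) y.1 :=
      mul_mem (pow_mem (mem_denAt hU ⟨y.1, iV.le y.2⟩) _) (hf y).1
    refine ⟨V, hV, iV.le, _, ⟨_, h₁⟩, ⟨_, h₂⟩, hq, fun y => ?_⟩
    obtain ⟨hy, e⟩ := hf y
    rw [HomogeneousLocalization.val_mk]
    exact ((congrArg (tpow t (-n) (mem_denAt hU ⟨y.1, iV.le y.2⟩) * ·) e).trans
      (Localization.mk_mul _ _ _ _)).symm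
  have hc (x : U) : ∃ c : HomogeneousLocalization 𝒜 (denAt (𝒜 := 𝒜) x.1),
      c.val = tpow t (-n) (mem_denAt hU x) * f.1 x := by
    obtain ⟨V, hV, i, k, p, q, hq, h⟩ := key x
    exact ⟨_, h ⟨x.1, hV⟩⟩
  choose c hc using hc
  refine ⟨⟨c, fun x => ?_⟩, ?_⟩
  · obtain ⟨V, hV, i, k, p, q, hq, h⟩ := key x
    exact ⟨V, hV, homOfLE i, k, p, q, hq, fun y =>
      HomogeneousLocalization.val_injective _ ((hc _).trans (h y).symm)⟩
  · refine Subtype.ext (funext fun x => ?_)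
    refine (congrArg (tpow t n (mem_denAt hU x) * ·) (hc x)).trans ?_
    exact tpow_mul_cancel t n _ _

/-- Multiplication with `t ^ n`, as an isomorphism of modules. -/
def mulTpowEquiv {t : A} (ht : t ∈ 𝒜 1) (n : ℤ) {U : (Proj 𝒜).Opens}
    (hU : U ≤ Proj.basicOpen 𝒜 t) : Γ(Proj 𝒜, U) ≃ₗ[Γ(Proj 𝒜, U)] twistSections 𝒜 n U :=
  LinearEquiv.ofBijective (mulTpow ht n hU) ⟨mulTpow_injective ht n hU, mulTpow_surjective ht n hU⟩

/-- Multiplication with `t ^ n`, as an isomorphism `𝒪|_{D₊(t)} ≅ 𝒪(n)|_{D₊(t)}` of sheaves of modules. -/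
def restrictTpow {t : A} (ht : t ∈ 𝒜 1) (n : ℤ) :
    (oMod (Proj 𝒜)).restrict (Proj.basicOpen 𝒜 t).ι ≅
      (twist 𝒜 n).restrict (Proj.basicOpen 𝒜 t).ι :=
  (SheafOfModules.fullyFaithfulForget _).preimageIso
    (mkIso (M := ((oMod (Proj 𝒜)).restrict (Proj.basicOpen 𝒜 t).ι).val)
      (N := ((twist 𝒜 n).restrict (Proj.basicOpen 𝒜 t).ι).val)
      (fun U =>
        { toFun := fun s => mulTpowEquiv ht n (Scheme.Opens.ι_image_le _ U.unop) s
          invFun := fun s => (mulTpowEquiv ht n (Scheme.Opens.ι_image_le _ U.unop)).symm s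
          map_add' := fun a b => map_add (mulTpowEquiv ht n (Scheme.Opens.ι_image_le _ U.unop)) a b
          map_smul' := fun r a =>
            (mulTpowEquiv ht n (Scheme.Opens.ι_image_le _ U.unop)).map_smul
              (((Proj.basicOpen 𝒜 t).ι.appIso U.unop).inv r) a
          left_inv := fun a => LinearEquiv.symm_apply_apply _ a
          right_inv := fun a => LinearEquiv.apply_symm_apply _ a })
      (fun _ _ => rfl))

/-- The isomorphism `t ^ n : 𝒪 ≅ i^* 𝒪(n)` on `D₊(t)`, where `i` is the inclusion of `D₊(t)`. -/
def pullbackTpow {t : A} (ht : t ∈ 𝒜 1) (n : ℤ) :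
    oMod (Proj.basicOpen 𝒜 t).toScheme ≅
      (Scheme.Modules.pullback (Proj.basicOpen 𝒜 t).ι).obj (twist 𝒜 n) :=
  (Scheme.Modules.restrictUnitIso (Proj.basicOpen 𝒜 t).ι).symm ≪≫ restrictTpow ht n ≪≫
    (Scheme.Modules.restrictFunctorIsoPullback (Proj.basicOpen 𝒜 t).ι).app (twist 𝒜 n)

end Twist

section ProjectiveSpace

open MvPolynomial

/-- The grading of `ℤ[x₀, …, x_r]` by degree. -/
abbrev polyGrading (r : ℕ) :
    ℕ → Submodule (ULift.{u} ℤ) (MvPolynomial (Fin (r + 1)) (ULift.{u} ℤ)) :=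
  homogeneousSubmodule (Fin (r + 1)) (ULift.{u} ℤ)

instance (r : ℕ) : GradedRing (polyGrading.{u} r) := MvPolynomial.gradedAlgebra

/-- The scheme `Proj ℤ[x₀, …, x_r]`. -/
def projInt (r : ℕ) : Scheme.{u} := Proj (polyGrading.{u} r)

/-- The projective space `ℙ^r_X = X ×_ℤ Proj ℤ[x₀, …, x_r]`. -/
def projSpace (r : ℕ) (X : Scheme.{u}) : Scheme.{u} :=
  Limits.pullback (terminal.from X) (terminal.from (projInt.{u} r))

namespace projSpace

variable {r : ℕ} {X Y : Scheme.{u}}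

variable (r X) in
/-- The projection `ℙ^r_X ⟶ X`. -/
def toBase : projSpace r X ⟶ X := pullback.fst _ _

variable (r X) in
/-- The projection `ℙ^r_X ⟶ Proj ℤ[x₀, …, x_r]`. -/
def toProj : projSpace r X ⟶ projInt.{u} r := pullback.snd _ _

/-- The morphism `f × 1 : ℙ^r_Y ⟶ ℙ^r_X` induced by `f : Y ⟶ X`. -/
def map (r : ℕ) (f : Y ⟶ X) : projSpace r Y ⟶ projSpace r X :=
  pullback.lift (toBase r Y ≫ f) (toProj r Y) (terminal.hom_ext _ _)

end projSpace

/-- The standard affine open subscheme `D₊(x_k) = Spec ℤ[x₀/x_k, …, x_r/x_k]` of `Proj ℤ[x₀, …, x_r]`. -/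
def intChart {r : ℕ} (k : Fin (r + 1)) : (projInt.{u} r).Opens :=
  Proj.basicOpen (polyGrading.{u} r) (X k)

/-- The open subscheme `U_k = X ×_ℤ Spec ℤ[x₀/x_k, …, x_r/x_k]` of `ℙ^r_X`, the preimage of `D₊(x_k)`. -/
def chart {r : ℕ} (X : Scheme.{u}) (k : Fin (r + 1)) : (projSpace r X).Opens :=
  projSpace.toProj r X ⁻¹ᵁ intChart k

/-- The projection `U_k ⟶ D₊(x_k)`. -/
def chartToInt {r : ℕ} (X : Scheme.{u}) (k : Fin (r + 1)) :
    (chart X k).toScheme ⟶ (intChart.{u} k).toScheme :=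
  projSpace.toProj r X ∣_ intChart k

lemma chartToInt_ι {r : ℕ} (X : Scheme.{u}) (k : Fin (r + 1)) :
    (chart X k).ι ≫ projSpace.toProj r X = chartToInt X k ≫ (intChart k).ι :=
  (morphismRestrict_ι _ _).symm

/-- The sieve on `ℙ^r_X` generated by the inclusions `i_k : U_k ⟶ ℙ^r_X`. -/
def chartSieve (r : ℕ) (X : Scheme.{u}) : Sieve (projSpace r X) :=
  Sieve.ofArrows (fun k : Fin (r + 1) => (chart X k).toScheme) (fun k => (chart X k).ι)

/-- Serre's sheaf `𝒪(n)` on `Proj ℤ[x₀, …, x_r]`. -/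
def intTwist (r : ℕ) (n : ℤ) : (projInt.{u} r).Modules := twist (polyGrading.{u} r) n

/-- The ordinary twisting sheaf `𝒪(n)` on `ℙ^r_X`, a sheaf of modules on `ℙ^r_X`. -/
def serre (r : ℕ) (X : Scheme.{u}) (n : ℤ) : (projSpace r X).Modules :=
  (Scheme.Modules.pullback (projSpace.toProj r X)).obj (intTwist r n)

/-- The isomorphism `x_k ^ n : 𝒪 ≅ i^* 𝒪(n)` on `D₊(x_k)`. -/
def intChartTpow {r : ℕ} (k : Fin (r + 1)) (n : ℤ) :
    oMod (intChart.{u} k).toScheme ≅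
      (Scheme.Modules.pullback (intChart k).ι).obj (intTwist r n) :=
  pullbackTpow (𝒜 := polyGrading.{u} r) (t := X k) (isHomogeneous_X _ k) n

/-- The isomorphism `x_k ^ n : 𝒪 ≅ i_k^* 𝒪(n)` on `U_k`. -/
def chartTpow {r : ℕ} (X : Scheme.{u}) (k : Fin (r + 1)) (n : ℤ) :
    oMod (chart X k).toScheme ≅ (Scheme.Modules.pullback (chart X k).ι).obj (serre r X n) :=
  (unitIso (chartToInt X k)).symm ≪≫
    (Scheme.Modules.pullback (chartToInt X k)).mapIso (intChartTpow k n) ≪≫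
    cmp (chartToInt X k) (intChart k).ι _ rfl (intTwist r n) ≪≫
    (cmp (chart X k).ι (projSpace.toProj r X) _ (chartToInt_ι X k) (intTwist r n)).symm

/-- The morphism `h` to `ℙ^r_X` factors through `U_k`. -/
def FactorsThroughChart {r : ℕ} {X Z : Scheme.{u}} (h : Z ⟶ projSpace r X) (k : Fin (r + 1)) :
    Prop :=
  ∃ t : Z ⟶ (chart X k).toScheme, t ≫ (chart X k).ι = h

lemma exists_factorsThroughChart {r : ℕ} {X : Scheme.{u}} (Z : SieveCat (chartSieve r X)) :
    ∃ k, FactorsThroughChart (str Z.obj) k := by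
  obtain ⟨W, t, _, ⟨k⟩, e⟩ := Z.property
  exact ⟨k, t, e⟩

open Classical in
/-- The largest `k` such that the morphism `h : Z ⟶ ℙ^r_X` in the sieve factors through `U_k`. -/
def chartIndex {r : ℕ} {X : Scheme.{u}} (Z : SieveCat (chartSieve r X)) : Fin (r + 1) :=
  (Finset.univ.filter (FactorsThroughChart (str Z.obj))).max'
    ((exists_factorsThroughChart Z).imp fun _ hk => Finset.mem_filter.mpr ⟨Finset.mem_univ _, hk⟩)

open Classical in
lemma factorsThroughChart_chartIndex {r : ℕ} {X : Scheme.{u}} (Z : SieveCat (chartSieve r X)) :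
    FactorsThroughChart (str Z.obj) (chartIndex Z) :=
  (Finset.mem_filter.mp (Finset.max'_mem (Finset.univ.filter (FactorsThroughChart (str Z.obj)))
    _)).2

/-- The factorization `h_k : Z ⟶ U_k` of `h : Z ⟶ ℙ^r_X`, for the largest possible `k`. -/
def toChart {r : ℕ} {X : Scheme.{u}} (Z : SieveCat (chartSieve r X)) :
    Z.obj.left ⟶ (chart X (chartIndex Z)).toScheme :=
  (factorsThroughChart_chartIndex Z).choose

lemma toChart_ι {r : ℕ} {X : Scheme.{u}} (Z : SieveCat (chartSieve r X)) :
    toChart Z ≫ (chart X (chartIndex Z)).ι = str Z.obj :=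
  (factorsThroughChart_chartIndex Z).choose_spec

/-- The isomorphism `α_h : 𝒪_Z ≅ h_k^* 𝒪_{U_k} ≅ h_k^* i_k^* 𝒪(n) ≅ h^* 𝒪(n)` on `Z`, given by `x_k ^ n`
for the largest possible `k`. -/
def alpha {r : ℕ} {X : Scheme.{u}} (n : ℤ) (Z : SieveCat (chartSieve r X)) :
    oMod Z.obj.left ≅ (Scheme.Modules.pullback (str Z.obj)).obj (serre r X n) :=
  (unitIso (toChart Z)).symm ≪≫
    (Scheme.Modules.pullback (toChart Z)).mapIso (chartTpow X (chartIndex Z) n) ≪≫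
    cmp (toChart Z) (chart X (chartIndex Z)).ι (str Z.obj) (toChart_ι Z) (serre r X n)

/-- The restriction of an isomorphism to `C_H`. -/
def restrictIso {X : Scheme.{u}} {F G : BigPresheaf X} (e : F ≅ G) (H : Sieve X) :
    F.restrict H ≅ G.restrict H :=
  (PresheafOfModules.pushforward₀ (SieveCat.incl H) (bigRing X)).mapIso e

/-- The restriction of `𝒪^n` to `C_H` is `(𝒪|_H)^n`. -/
def freeRestrictIso {X : Scheme.{u}} (H : Sieve X) (n : ℕ) :
    free (sieveRing H) n ≅ BigPresheaf.restrict (free (bigRing X) n) H :=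
  Iso.refl (free (sieveRing H) n)

/-- The isomorphism `φ_h : 𝒪 ≅ B 𝒪_Z ≅ B h^* 𝒪(n) ≅ h^* (B 𝒪(n)|_H)` for `h : Z ⟶ ℙ^r_X` in the sieve `H`
generated by the `U_k`. -/
def phi {r : ℕ} {X : Scheme.{u}} (n : ℤ) (Z : SieveCat (chartSieve r X)) :
    free (sieveRing ((chartSieve r X).pullback (str Z.obj))) 1 ≅
      ((bigExt (serre r X n)).restrict (chartSieve r X)).pullback (str Z.obj) :=
  freeRestrictIso _ 1 ≪≫ restrictIso (bigExtUnit _ ≪≫ bigExtMapIso (alpha n Z)) _ ≪≫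
    bigExtResIso (str Z.obj) (chartSieve r X) (serre r X n)

/-- A pair `(H, E)` of a sieve `H` on `X` and an `H`-presheaf `E`. -/
structure SievePair (X : Scheme.{u}) where
  sieve : Sieve X
  presheaf : HPresheaf sieve

/-- The pullback `f^* (H, E) = (f^* H, f^* E)`. -/
def SievePair.pullback {X Y : Scheme.{u}} (f : Y ⟶ X) (E : SievePair X) : SievePair Y where
  sieve := E.sieve.pullback f
  presheaf := E.presheaf.pullback f

/-- The pair `(H, E)` is a standard vector bundle of rank `n`: the sieve `H` contains a Zariski covering
of `X`, and for each `f : Y ⟶ X` in `H` one has `E(Y) = Γ(Y, 𝒪_Y)^n` and the map `𝒪_Y^n ⟶ f^* E`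
induced by the standard basis is an isomorphism. -/
def SievePair.IsStandardVectorBundle {X : Scheme.{u}} (E : SievePair X) (n : ℕ) : Prop :=
  E.sieve ∈ Scheme.zariskiTopology X ∧ ∀ Y : SieveCat E.sieve, IsStandardFreeAt E.presheaf Y n

/-- A standard line bundle is a standard vector bundle of rank `1`. -/
def SievePair.IsStandardLineBundle {X : Scheme.{u}} (E : SievePair X) : Prop :=
  E.IsStandardVectorBundle 1

/-- The standard line bundle `𝒪(n)` on `ℙ^r_X`: the standardization `S_H^φ (B 𝒪(n)|_H)`. -/
def stdTwist (r : ℕ) (X : Scheme.{u}) (n : ℤ) : SievePair (projSpace r X) where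
  sieve := chartSieve r X
  presheaf := standardize ((bigExt (serre r X n)).restrict (chartSieve r X)) (fun _ => 1) (phi n)

end ProjectiveSpace

end StdBundle

end

/-! Everything in `stdTwist r X n` is determined by data on `Proj ℤ[x₀, …, x_r]`. The projection
`ℙ^r_Y ⟶ Proj` is the composite of `ℙ^r_Y ⟶ ℙ^r_X` with the projection of `ℙ^r_X`, so nothing
changes under base change.

Sieves. The chart `U_k` is the fibre product of `ℙ^r_X` with `D₊(x_k)` over `Proj`, so a morphism
factors through `U_k` exactly when its composite to `Proj` factors through `D₊(x_k)`
(`factorsThroughChart_iff`). Hence the sieves agree (`chartSieve_pullback`), and so do the largest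
indices `k` (`chartIndex_eq`).

Restriction maps. The inverse image of `serre r X n` is only canonically isomorphic to `serre r Y
n`, so the maps cannot be compared inside one sheaf. Instead, the graph of a restriction map is
described: `s` goes to `t` when the section `t · x_l ^ n` is the restriction of `s · x_k ^ n`.
Canonical isomorphisms commute with restriction and are injective on sections, so this relation can
be moved from `serre r X n` to the inverse images of `𝒪(n)` along morphisms to `Proj`
(`restricts_trans_pullIso_iff`, `alpha_pullIso`). The outcome, `isStandardizedRestriction_phi_iff`,
mentions only `n`, the morphism of schemes, the two indices and the two morphisms to charts of
`Proj`, all of which are the same for `X` and for `Y`. Since modules of sections are the standard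
`Γ(Z, 𝒪_Z)^1` on both sides, equal graphs give equality of the pairs
(`SievePair.pullback_standardize_eq`).

Standardness. The charts cover because the variables generate the irrelevant ideal. For any
standardization, the map induced by the standard basis becomes the given isomorphism `φ_f` after
composition with bijections, so it is bijective (`isStandardFreeAt_standardize`). -/

noncomputable section

namespace StdBundle

/-! ### The charts of projective space and the sieve they generate. -/

section Sieves

open MvPolynomial

/-- The open subschemes `D₊(x_k)` cover `Proj ℤ[x₀, …, x_r]`. -/
lemma iSup_intChart (r : ℕ) : ⨆ k : Fin (r + 1), intChart.{u} k = ⊤ := by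
  refine Proj.iSup_basicOpen_eq_top (polyGrading.{u} r)
    (fun k : Fin (r + 1) => (X k : MvPolynomial (Fin (r + 1)) (ULift.{u} ℤ))) ?_
  rw [HomogeneousIdeal.toIdeal_irrelevant_le]
  intro i hi p hp
  rw [← Set.image_univ]
  refine mem_ideal_span_X_image.mpr fun m hm => ?_
  by_contra! h
  -- A monomial containing no variable is constant, hence of degree `0`, while every monomial of `p`
  -- has degree `i > 0`.
  have hm0 : m = 0 := Finsupp.ext fun j => h j (Set.mem_univ j)
  have hd : Finsupp.weight 1 m = i :=
    (mem_homogeneousSubmodule i p).mp hp (mem_support_iff.mp hm)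
  rw [hm0, map_zero] at hd
  exact hi.ne hd

/-- A morphism to `ℙ^r_X` factors through `U_k` if and only if its composite with the projection to
`Proj ℤ[x₀, …, x_r]` factors through `D₊(x_k)`. -/
lemma factorsThroughChart_iff {r : ℕ} {X Z : Scheme.{u}} (h : Z ⟶ projSpace r X) (k : Fin (r + 1)) :
    FactorsThroughChart h k ↔
      ∃ t : Z ⟶ (intChart.{u} k).toScheme, t ≫ (intChart k).ι = h ≫ projSpace.toProj r X := by
  constructor
  · rintro ⟨t, rfl⟩
    exact ⟨t ≫ chartToInt X k, by rw [Category.assoc, Category.assoc, chartToInt_ι]⟩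
  · rintro ⟨t, ht⟩
    -- `U_k` is the preimage of `D₊(x_k)`, which is a fibre product; its universal property gives
    -- the factorization.
    have hp := isPullback_morphismRestrict (projSpace.toProj r X) (intChart k)
    exact ⟨hp.lift t h ht, hp.lift_snd _ _ _⟩

lemma chartSieve_apply_iff {r : ℕ} {X Z : Scheme.{u}} (h : Z ⟶ projSpace r X) :
    chartSieve r X h ↔ ∃ k, FactorsThroughChart h k := by
  constructor
  · rintro ⟨W, t, _, ⟨k⟩, e⟩
    exact ⟨k, t, e⟩
  · rintro ⟨k, t, e⟩
    exact ⟨_, t, _, ⟨k⟩, e⟩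

lemma projSpace.map_toProj (r : ℕ) {X Y : Scheme.{u}} (f : Y ⟶ X) :
    projSpace.map r f ≫ projSpace.toProj r X = projSpace.toProj r Y :=
  pullback.lift_snd _ _ _

/-- Both conditions concern the same morphism to `Proj`, because `f × 1` commutes with the
projections to it. -/
lemma factorsThroughChart_comp_map {r : ℕ} {X Y Z : Scheme.{u}} (f : Y ⟶ X)
    (h : Z ⟶ projSpace r Y) (k : Fin (r + 1)) :
    FactorsThroughChart (h ≫ projSpace.map r f) k ↔ FactorsThroughChart h k := by
  rw [factorsThroughChart_iff, factorsThroughChart_iff, Category.assoc, projSpace.map_toProj]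

/-- The sieve generated by the charts of projective space is compatible with base change. -/
lemma chartSieve_pullback (r : ℕ) {X Y : Scheme.{u}} (f : Y ⟶ X) :
    (chartSieve r X).pullback (projSpace.map r f) = chartSieve r Y := by
  ext Z h
  simp only [Sieve.pullback_apply]
  rw [chartSieve_apply_iff, chartSieve_apply_iff]
  simp only [factorsThroughChart_comp_map]

/-- The charts are the preimages of the `D₊(x_k)`, and preimages of a covering form a covering. -/
lemma chartSieve_mem_zariskiTopology (r : ℕ) (X : Scheme.{u}) :
    chartSieve r X ∈ Scheme.zariskiTopology (projSpace r X) := by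
  have hc : TopologicalSpace.IsOpenCover (fun k : Fin (r + 1) => chart X k) := by
    rw [TopologicalSpace.IsOpenCover]
    have h := congrArg (fun U => projSpace.toProj r X ⁻¹ᵁ U) (iSup_intChart.{u} r)
    rw [Scheme.Hom.preimage_iSup, Scheme.Hom.preimage_top] at h
    exact h
  have h := Scheme.Cover.mem_grothendieckTopology
    ((projSpace r X).openCoverOfIsOpenCover (fun k : Fin (r + 1) => chart X k) hc)
  exact h

/-- The largest index of a chart depends only on the composite with the projection to
`Proj ℤ[x₀, …, x_r]`. -/
lemma chartIndex_eq {r : ℕ} {X Y : Scheme.{u}} (Z : SieveCat (chartSieve r X))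
    (W : SieveCat (chartSieve r Y))
    (h : ∀ k, FactorsThroughChart (str Z.obj) k ↔ FactorsThroughChart (str W.obj) k) :
    chartIndex Z = chartIndex W := by
  have h' : FactorsThroughChart (str Z.obj) = FactorsThroughChart (str W.obj) :=
    funext fun k => propext (h k)
  unfold chartIndex
  congr 2

end Sieves

/-! ### Equality of presheaves whose modules of sections are standard. -/

section StandardForm

variable {P : Scheme.{u}}

/-- Two `H`-presheaves with standard modules of sections `Γ(Y, 𝒪_Y)^n` are equal, together with their
sieves, if the sieves are equal and the restriction maps agree on all sections. -/
lemma SievePair.mk_mkPresheaf_eq {H H' : Sieve P} (hH : H = H') {n : ℕ}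
    (map : ∀ {Z W : (SieveCat H)ᵒᵖ} (g : Z ⟶ W),
      ModuleCat.of ((sieveRing H).obj Z) (Fin n → (sieveRing H).obj Z) →ₛₗ[((sieveRing H).map g).hom]
        ModuleCat.of ((sieveRing H).obj W) (Fin n → (sieveRing H).obj W))
    (map_id) (map_comp)
    (map' : ∀ {Z W : (SieveCat H')ᵒᵖ} (g : Z ⟶ W),
      ModuleCat.of ((sieveRing H').obj Z) (Fin n → (sieveRing H').obj Z) →ₛₗ[
        ((sieveRing H').map g).hom]
        ModuleCat.of ((sieveRing H').obj W) (Fin n → (sieveRing H').obj W))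
    (map_id') (map_comp')
    (h : ∀ (Z W : Over P) (hZ : H.arrows Z.hom) (hW : H.arrows W.hom) (hZ' : H'.arrows Z.hom)
      (hW' : H'.arrows W.hom) (g : W ⟶ Z) (s : Fin n → globRing Z.left),
      (map (Z := op ⟨Z, hZ⟩) (W := op ⟨W, hW⟩) (ObjectProperty.homMk g).op s :
        Fin n → globRing W.left) =
      map' (Z := op ⟨Z, hZ'⟩) (W := op ⟨W, hW'⟩) (ObjectProperty.homMk g).op s) :
    SievePair.mk H (mkPresheaf (sieveRing H) (fun Z => ModuleCat.of _ (Fin n → (sieveRing H).obj Z))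
        map map_id map_comp) =
      SievePair.mk H' (mkPresheaf (sieveRing H')
        (fun Z => ModuleCat.of _ (Fin n → (sieveRing H').obj Z)) map' map_id' map_comp') := by
  subst hH
  -- With the sieves identified, the modules of sections coincide literally, and the remaining
  -- fields are proofs. Only the restriction maps are left to compare.
  have e : @map = @map' := by
    funext Z W g
    exact LinearMap.ext fun s => h Z.unop.obj W.unop.obj Z.unop.property W.unop.property
      Z.unop.property W.unop.property g.unop.hom s
  subst e
  rfl

end StandardForm

/-! ### Standardizations are standard free. -/

section Standardize

variable {X : Scheme.{u}} {H : Sieve X}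

/-- Describing the restriction map by its graph removes the inverse of `φ` from its definition. All
later comparisons use this form. -/
lemma standardizeMap_eq_iff {E : HPresheaf H} {n : SieveCat H → ℕ}
    (φ : ∀ Y : SieveCat H,
      free (sieveRing (H.pullback (str Y.obj))) (n Y) ≅ E.pullback (str Y.obj))
    {Y Z : (SieveCat H)ᵒᵖ} (g : Y ⟶ Z)
    (s : (free (sieveRing (H.pullback (str Y.unop.obj))) (n Y.unop)).obj (op Y.unop.idObj))
    (t : (free (sieveRing (H.pullback (str Z.unop.obj))) (n Z.unop)).obj (op Z.unop.idObj)) :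
    standardizeMap φ g s = t ↔
      standardizeEquiv φ Z.unop t = sameRestrict E g (standardizeEquiv φ Y.unop s) := by
  rw [eq_comm, eq_comm (b := sameRestrict _ _ _)]
  exact (LinearEquiv.eq_symm_apply _).trans eq_comm

/-- A morphism of presheaves of modules is an isomorphism if it is bijective on sections. -/
lemma isIso_of_bijective {C : Type*} [Category C] {R : Cᵒᵖ ⥤ RingCat.{u}}
    {M N : PresheafOfModules.{u} R} (f : M ⟶ N)
    (hf : ∀ Z, Function.Bijective (f.app Z)) : IsIso f := by
  let e : M ≅ N := PresheafOfModules.isoMk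
    (fun Z => (LinearEquiv.ofBijective (f.app Z).hom (hf Z)).toModuleIso)
    (fun Z W g => f.naturality g)
  have : f = e.hom := by
    ext Z s
    rfl
  rw [this]
  infer_instance

/-- The identity of `Y`, as an isomorphism from `𝟙 ≫ f : Y ⟶ X` to `f : Y ⟶ X`. -/
def SieveCat.sameIso (Y : SieveCat H) : (SieveCat.same H).obj Y ≅ Y :=
  ObjectProperty.isoMk _ (Over.isoMk (Iso.refl _) (by
    change 𝟙 _ ≫ str Y.obj = 𝟙 _ ≫ str Y.obj
    rfl))

/-- The structure morphism of `Z` as a morphism to the identity of `Y`. -/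
def SieveCat.toIdObj (Y : SieveCat H) (Z : SieveCat (H.pullback (str Y.obj))) : Z ⟶ Y.idObj :=
  ObjectProperty.homMk (Over.homMk (str Z.obj) (Category.comp_id _))

/-- For `k : Z ⟶ Y` over `f`, all the morphisms involved have `k` or an identity as underlying
morphism of schemes. They differ only in whether a structure morphism is written `f` or `𝟙 ≫ f`. -/
lemma SieveCat.sameIso_toIdObj (Y : SieveCat H) (Z : SieveCat (H.pullback (str Y.obj))) :
    (SieveCat.sameIso ((SieveCat.post (str Y.obj) H).obj Z)).hom ≫
      (SieveCat.post (str Y.obj) H).map (SieveCat.toIdObj Y Z) =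
    (SieveCat.same H).map (SieveCat.toPost Y Z) := by
  apply ObjectProperty.hom_ext
  ext1
  exact Category.id_comp _

lemma sameRestrict_toPost (E : HPresheaf H) (Y : SieveCat H)
    (Z : SieveCat (H.pullback (str Y.obj))) (x : (E.pullback (str Y.obj)).obj (op Y.idObj)) :
    sameRestrict E (SieveCat.toPost Y Z).op x =
      E.map (SieveCat.sameIso ((SieveCat.post (str Y.obj) H).obj Z)).hom.op
        ((E.pullback (str Y.obj)).map (SieveCat.toIdObj Y Z).op x) :=
  (E.congr_map_apply (congrArg Quiver.Hom.op (SieveCat.sameIso_toIdObj Y Z)).symm x).trans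
    (E.map_comp_apply ((SieveCat.post (str Y.obj) H).map (SieveCat.toIdObj Y Z)).op
      (SieveCat.sameIso ((SieveCat.post (str Y.obj) H).obj Z)).hom.op x)

/-- This is naturality of `φ_f` along `k`, viewed as a morphism from `k` to the identity in `C_{f^*
H}`: restricting `φ_f(s)` is the same as applying `φ_f` over `k` to the restricted vector. -/
lemma sameRestrict_standardizeEquiv {E : HPresheaf H} {n : SieveCat H → ℕ}
    (φ : ∀ Y : SieveCat H,
      free (sieveRing (H.pullback (str Y.obj))) (n Y) ≅ E.pullback (str Y.obj))
    (Y : SieveCat H) (Z : SieveCat (H.pullback (str Y.obj)))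
    (s : (free (sieveRing (H.pullback (str Y.obj))) (n Y)).obj (op Y.idObj)) :
    sameRestrict E (SieveCat.toPost Y Z).op (standardizeEquiv φ Y s) =
      E.map (SieveCat.sameIso ((SieveCat.post (str Y.obj) H).obj Z)).hom.op
        ((φ Y).hom.app (op Z) ((free (sieveRing (H.pullback (str Y.obj))) (n Y)).map
          (SieveCat.toIdObj Y Z).op s)) := by
  have h := PresheafOfModules.naturality_apply (φ Y).hom (SieveCat.toIdObj Y Z).op s
  rw [sameRestrict_toPost]
  exact congrArg (fun y => E.map (SieveCat.sameIso ((SieveCat.post (str Y.obj) H).obj Z)).hom.op y)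
    h.symm

/-- The hypothesis `h` says that `L ∘ linearCombination` and `v ∘ e` agree on the standard basis, so
they are equal, and `L`, `v`, `e` are bijective. The map `v` is semilinear over a `σ` that is only
provably the identity, since it will be a restriction map along an identity of schemes. -/
lemma bijective_linearCombination {R M N₁ N₂ : Type*} [Ring R] [AddCommGroup M] [AddCommGroup N₁]
    [AddCommGroup N₂] [Module R M] [Module R N₁] [Module R N₂] {n : ℕ} (p : Fin n → M)
    (L : M ≃ₗ[R] N₁) (σ : R →+* R) (hσ : σ = RingHom.id R) (v : N₂ →ₛₗ[σ] N₁)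
    (hv : Function.Bijective v) (e : (Fin n → R) →ₗ[R] N₂) (he : Function.Bijective e)
    (h : ∀ i, L (p i) = v (e (Pi.single i 1))) :
    Function.Bijective (Fintype.linearCombination R p) := by
  subst hσ
  have h' : L.toLinearMap.comp (Fintype.linearCombination R p) = v.comp e := by
    refine LinearMap.pi_ext' fun i => LinearMap.ext_ring ?_
    simpa using h i
  refine (Function.Bijective.of_comp_iff' L.bijective _).mp ?_
  have h'' : L ∘ Fintype.linearCombination R p = v ∘ e := congrArg DFunLike.coe h'
  rw [h'']
  exact hv.comp he

lemma bijective_map_iso {C : Type*} [Category C] {R : Cᵒᵖ ⥤ RingCat.{u}}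
    (M : PresheafOfModules.{u} R) {Z W : Cᵒᵖ} (e : Z ≅ W) :
    Function.Bijective (M.restrictₛₗ e.hom) := by
  refine Function.bijective_iff_has_inverse.mpr ⟨M.restrictₛₗ e.inv, fun x => ?_, fun x => ?_⟩
  · refine (M.map_comp_apply _ _ _).symm.trans ((M.congr_map_apply e.hom_inv_id x).trans ?_)
    rw [M.map_id]
    rfl
  · refine (M.map_comp_apply _ _ _).symm.trans ((M.congr_map_apply e.inv_hom_id x).trans ?_)
    rw [M.map_id]
    rfl

/-- The standardization of an `H`-presheaf is standard free. -/
lemma isStandardFreeAt_standardize (E : HPresheaf H) (n : SieveCat H → ℕ)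
    (φ : ∀ Y : SieveCat H,
      free (sieveRing (H.pullback (str Y.obj))) (n Y) ≅ E.pullback (str Y.obj))
    (Y : SieveCat H) : IsStandardFreeAt (standardize E n φ) Y (n Y) := by
  -- The modules of sections of a standardization are the standard free ones by definition.
  refine ⟨rfl, isIso_of_bijective _ fun Z => ?_⟩
  obtain ⟨Z⟩ := Z
  let W := (SieveCat.post (str Y.obj) H).obj Z
  have hv := bijective_map_iso E (SieveCat.sameIso W).op
  have he : Function.Bijective ((φ Y).hom.app (op Z)) :=
    ((PresheafOfModules.evaluation _ (op Z)).mapIso (φ Y)).toLinearEquiv.bijective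
  -- The scalars are the functions on one scheme, reached through different sieves. These instances
  -- put all modules over one name of that ring.
  let : Module ((sieveRing (H.pullback (str Y.obj))).obj (op Z))
      ((E.pullback (str W.obj)).obj (op W.idObj)) :=
    ((E.pullback (str W.obj)).obj (op W.idObj)).isModule
  let : Module ((sieveRing (H.pullback (str Y.obj))).obj (op Z)) (E.obj (op W)) :=
    (E.obj (op W)).isModule
  -- Here `L` is `φ_{k ≫ f}` at the identity, `e` is `φ_f` over `k`, and `v` is the change from `k ≫
  -- f` to `𝟙 ≫ k ≫ f`.
  refine bijective_linearCombination (R := (sieveRing (H.pullback (str Y.obj))).obj (op Z))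
    (fun i => pullSection (standardize E n φ) Y (Pi.single i (1 : globRing Y.obj.left)) (op Z))
    (standardizeEquiv φ W) (glob (𝟙 Z.obj.left)) (glob_id _) (E.restrictₛₗ (SieveCat.sameIso W).hom.op)
    hv ((φ Y).hom.app (op Z)).hom he fun i => ?_
  have h₁ := (standardizeMap_eq_iff φ (SieveCat.toPost Y Z).op
    (Pi.single i (1 : globRing Y.obj.left)) _).mp rfl
  refine (h₁.trans (sameRestrict_standardizeEquiv φ Y Z _)).trans ?_
  -- Ring homomorphisms preserve `0` and `1`, so standard basis vectors restrict to standard basis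
  -- vectors.
  have h₂ : (free (sieveRing (H.pullback (str Y.obj))) (n Y)).map (SieveCat.toIdObj Y Z).op
      (Pi.single i (1 : globRing Y.obj.left) : Fin (n Y) → globRing Y.obj.left) =
      (Pi.single i (1 : globRing Z.obj.left) : Fin (n Y) → globRing Z.obj.left) := by
    funext j
    change glob (str Z.obj) ((Pi.single i 1 : Fin (n Y) → globRing Y.obj.left) j) =
      (Pi.single i 1 : Fin (n Y) → globRing Z.obj.left) j
    rw [Pi.single_apply, Pi.single_apply]
    split_ifs
    · exact map_one _
    · exact map_zero _
  exact congrArg (fun x => E.map (SieveCat.sameIso W).hom.op ((φ Y).hom.app (op Z) x)) h₂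

end Standardize

/-! ### Trivializations of inverse images and their transport along `p : P ⟶ Q`. -/

section Trivialization

open Scheme

variable {P Q D U Y Z W : Scheme.{u}}

/-- The pullback along `t` of an isomorphism `𝒪 ≅ i^* M`, as an isomorphism `𝒪 ≅ h^* M`, where `h` is the
composite of `t` and `i`. -/
def pullTrivialization (t : Z ⟶ U) (i : U ⟶ P) (h : Z ⟶ P) (w : t ≫ i = h) (M : P.Modules)
    (τ : oMod U ≅ (Modules.pullback i).obj M) : oMod Z ≅ (Modules.pullback h).obj M :=
  (unitIso t).symm ≪≫ (Modules.pullback t).mapIso τ ≪≫ cmp t i h w M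

lemma unitIso_inv (t : Z ⟶ U) (a : globRing U) :
    secMap (unitIso t).inv (secUnit Z (glob t a)) = pullSec t (oMod U) (secUnit U a) := by
  rw [← unitIso_pullSec, ← secMap_comp, Iso.hom_inv_id, secMap_id]

/-- On sections that come from `U`, the pulled back trivialization is restriction of sections along
`t`. With `a = 1` this determines it completely, by `oMod_hom_ext`. -/
lemma pullTrivialization_apply (t : Z ⟶ U) (i : U ⟶ P) (h : Z ⟶ P) (w : t ≫ i = h) (M : P.Modules)
    (τ : oMod U ≅ (Modules.pullback i).obj M) (a : globRing U) :
    secMap (pullTrivialization t i h w M τ).hom (secUnit Z (glob t a)) =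
      bigPull t i h w M (secMap τ.hom (secUnit U a)) := by
  rw [pullTrivialization, Iso.trans_hom, Iso.trans_hom, Iso.symm_hom, secMap_comp, secMap_comp,
    unitIso_inv, bigPull_apply, pullSec_naturality, Functor.mapIso_hom]

/-- For an isomorphism `M ≅ p^* N`, the induced isomorphism `h^* M ≅ z^* N`, where `z` is the composite of
`h` and `p`. -/
def pullIso {M : P.Modules} {N : Q.Modules} {p : P ⟶ Q} (ε : M ≅ (Modules.pullback p).obj N)
    (h : Z ⟶ P) (z : Z ⟶ Q) (w : h ≫ p = z) :
    (Modules.pullback h).obj M ≅ (Modules.pullback z).obj N :=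
  (Modules.pullback h).mapIso ε ≪≫ cmp h p z w N

/-- Restriction is natural in the sheaf, which handles `ε`, and compatible with composition of
inverse images, which handles `cmp`. -/
lemma pullIso_bigPull {M : P.Modules} {N : Q.Modules} {p : P ⟶ Q}
    (ε : M ≅ (Modules.pullback p).obj N) (g : W ⟶ Z) (h : Z ⟶ P) (h' : W ⟶ P) (e : g ≫ h = h')
    (z : Z ⟶ Q) (z' : W ⟶ Q) (w : h ≫ p = z) (w' : h' ≫ p = z') (e' : g ≫ z = z')
    (s : sec ((Modules.pullback h).obj M)) :
    secMap (pullIso ε h' z' w').hom (bigPull g h h' e M s) =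
      bigPull g z z' e' N (secMap (pullIso ε h z w).hom s) := by
  have hn := bigPull_naturality g h h' e ε s
  rw [secIso_apply, secIso_apply] at hn
  rw [pullIso, pullIso, Iso.trans_hom, Iso.trans_hom, secMap_comp, secMap_comp, hn]
  exact cmp_bigPull_apply g h p h' z z' e w w' e' N _

lemma secMap_cancel {M N : Y.Modules} (e : M ≅ N) (a b : sec M) :
    secMap e.hom a = secMap e.hom b ↔ a = b := by
  rw [← secIso_apply, ← secIso_apply]
  exact (secIso e).injective.eq_iff

/-- Under the isomorphisms `b` and `b'`, the function `t` represents the restriction along `g` of the section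
represented by `s`. -/
def Restricts {N : Q.Modules} {z : Z ⟶ Q} {z' : W ⟶ Q} (b : oMod Z ≅ (Modules.pullback z).obj N)
    (b' : oMod W ≅ (Modules.pullback z').obj N) (g : W ⟶ Z) (e : g ≫ z = z') (s : globRing Z)
    (t : globRing W) : Prop :=
  secMap b'.hom (secUnit W t) = bigPull g z z' e N (secMap b.hom (secUnit Z s))

/-- `pullIso` commutes with restriction and is injective on sections, so the equation defining the
relation may be tested after applying it. This moves the relation from sheaves on `P` to sheaves on
`Q`. -/
lemma restricts_trans_pullIso_iff {M : P.Modules} {N : Q.Modules} {p : P ⟶ Q}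
    (ε : M ≅ (Modules.pullback p).obj N) {h : Z ⟶ P} {h' : W ⟶ P} {z : Z ⟶ Q} {z' : W ⟶ Q}
    (w : h ≫ p = z) (w' : h' ≫ p = z') (a : oMod Z ≅ (Modules.pullback h).obj M)
    (a' : oMod W ≅ (Modules.pullback h').obj M) (b : oMod Z ≅ (Modules.pullback z).obj N)
    (b' : oMod W ≅ (Modules.pullback z').obj N) (hb : a.hom ≫ (pullIso ε h z w).hom = b.hom)
    (hb' : a'.hom ≫ (pullIso ε h' z' w').hom = b'.hom) (g : W ⟶ Z) (e : g ≫ h = h')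
    (e' : g ≫ z = z') (s : globRing Z) (t : globRing W) :
    Restricts a a' g e s t ↔ Restricts b b' g e' s t := by
  rw [Restricts, Restricts, ← hb, ← hb', secMap_comp, secMap_comp,
    ← pullIso_bigPull ε g h h' e z z' w w' e', secMap_cancel]

/-- Trivializing in two stages, over `D` and then over `U`, agrees with trivializing directly along
`Z ⟶ D`: both maps send the section `1` to the restriction of `τ(1)`. -/
lemma pullTrivialization_trans (t : Z ⟶ U) (i : U ⟶ P) (h : Z ⟶ P) (w : t ≫ i = h) (p : P ⟶ Q)
    (c : U ⟶ D) (j : D ⟶ Q) (q : U ⟶ Q) (w₁ : c ≫ j = q) (w₂ : i ≫ p = q) (z : Z ⟶ Q)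
    (w₃ : h ≫ p = z) (tc : Z ⟶ D) (w₄ : t ≫ c = tc) (w₅ : tc ≫ j = z)
    {M : P.Modules} {N : Q.Modules} (ε : M ≅ (Modules.pullback p).obj N)
    (τ : oMod D ≅ (Modules.pullback j).obj N) :
    (pullTrivialization t i h w M (pullTrivialization c j q w₁ N τ ≪≫ (pullIso ε i q w₂).symm)).hom ≫
      (pullIso ε h z w₃).hom = (pullTrivialization tc j z w₅ N τ).hom := by
  have w₆ : t ≫ q = z := by rw [← w₁, ← Category.assoc, w₄, w₅]
  apply oMod_hom_ext
  -- Writing `1` as the image of `1` under `glob t`, `glob c` and `glob tc` in turn makes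
  -- `pullTrivialization_apply` applicable at each stage.
  rw [secMap_comp, ← map_one (glob t), pullTrivialization_apply,
    pullIso_bigPull ε t i h w q z w₂ w₃ w₆, ← secMap_comp, Iso.trans_hom, Iso.symm_hom,
    Category.assoc, Iso.inv_hom_id, Category.comp_id, ← map_one (glob c),
    pullTrivialization_apply, ← bigPull_comp t c j tc q z w₄ w₁ w₅ w₆, map_one (glob c),
    map_one (glob t), ← map_one (glob tc), pullTrivialization_apply]

end Trivialization

/-! ### Standardization of `B M` along trivializations of the sheaves `f^* M`. -/

section Trivialized

open Scheme

variable {P : Scheme.{u}} {H : Sieve P} {M : P.Modules}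

/-- The isomorphisms `𝒪_Y ≅ f^*(B M|_H)` of presheaves induced by isomorphisms `𝒪_Y ≅ f^* M` of
sheaves of modules. -/
def trivializationIso (α : ∀ Y : SieveCat H, oMod Y.obj.left ≅ (Modules.pullback (str Y.obj)).obj M)
    (Y : SieveCat H) :
    free (sieveRing (H.pullback (str Y.obj))) 1 ≅ ((bigExt M).restrict H).pullback (str Y.obj) :=
  freeRestrictIso _ 1 ≪≫ restrictIso (bigExtUnit _ ≪≫ bigExtMapIso (α Y)) _ ≪≫
    bigExtResIso (str Y.obj) H M

lemma standardizeEquiv_trivializationIso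
    (α : ∀ Y : SieveCat H, oMod Y.obj.left ≅ (Modules.pullback (str Y.obj)).obj M)
    (Y : SieveCat H) (s : Fin 1 → globRing Y.obj.left) :
    standardizeEquiv (trivializationIso α) Y s =
      (bigExtResIso (str Y.obj) H M).hom.app (op Y.idObj)
        ((bigExtMapIso (α Y)).hom.app (op Y.idObj.obj)
          ((bigExtUnit Y.obj.left).hom.app (op Y.idObj.obj) s)) := (rfl)

lemma sameRestrict_bigData (D : BigData P) {Z W : SieveCat H} (g : W ⟶ Z)
    (x : D.obj ((SieveCat.same H).obj Z).obj) :
    sameRestrict (D.toBig.restrict H) g.op x = D.res _ _ ((SieveCat.same H).map g).hom x := (rfl)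

lemma bigData_res (M : P.Modules) {Z W : Over P} (g : W ⟶ Z)
    (x : sec ((Modules.pullback (str Z)).obj M)) :
    (bigData M).res _ _ g x = bigPull g.left (str Z) (str W) (str_w g) M x := (rfl)

lemma bigData_res_sameIso (M : P.Modules) (Y : SieveCat H)
    (x : sec ((Modules.pullback (str Y.obj)).obj M)) :
    (bigData M).res _ _ (SieveCat.sameIso Y).hom.hom x =
      bigPull (𝟙 Y.obj.left) (str Y.obj) (𝟙 Y.obj.left ≫ str Y.obj) rfl M x := (rfl)

lemma unitIso_inv_id {Y : Scheme.{u}} (a : globRing Y) :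
    secMap (unitIso (𝟙 Y)).inv (secUnit Y a) = pullSec (𝟙 Y) (oMod Y) (secUnit Y a) := by
  have h := unitIso_inv (𝟙 Y) a
  have h₁ : glob (𝟙 Y) a = a := congr($(glob_id Y) a)
  rwa [h₁] at h

/-- The component of `φ_f` at the identity involves `𝟙^* α` and the isomorphism `𝟙^* f^* M ≅ (𝟙 ≫
f)^* M`, neither of which is trivial by definition. By naturality of pullback of sections, it is `α`
on global sections followed by restriction from `f` to `𝟙 ≫ f`. -/
lemma standardizeEquiv_eq_res
    (α : ∀ Y : SieveCat H, oMod Y.obj.left ≅ (Modules.pullback (str Y.obj)).obj M)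
    (Y : SieveCat H) (s : Fin 1 → globRing Y.obj.left) :
    standardizeEquiv (trivializationIso α) Y s =
      (bigData M).res _ _ (SieveCat.sameIso Y).hom.hom (secMap (α Y).hom (secUnit _ (s 0))) := by
  refine (standardizeEquiv_trivializationIso α Y s).trans ?_
  refine Eq.trans ?_ (bigData_res_sameIso M Y (secMap (α Y).hom (secUnit _ (s 0)))).symm
  have h : bigPull (𝟙 Y.obj.left) (str Y.obj) (𝟙 Y.obj.left ≫ str Y.obj) rfl M
      (secMap (α Y).hom (secUnit _ (s 0))) =
    secMap (cmp (𝟙 Y.obj.left) (str Y.obj) (𝟙 Y.obj.left ≫ str Y.obj) rfl M).hom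
      (secMap ((Modules.pullback (𝟙 Y.obj.left)).map (α Y).hom)
        (secMap (unitIso (𝟙 Y.obj.left)).inv (secUnit _ (s 0)))) := by
    rw [bigPull_apply, pullSec_naturality, unitIso_inv_id]
  exact h.symm

lemma BigData.res_injective (D : BigData P) {Z W : Over P} (g : W ≅ Z) :
    Function.Injective (D.res Z W g.hom) := by
  intro a b h
  have key (x : D.obj Z) : D.res W Z g.inv (D.res Z W g.hom x) = x := by
    rw [← D.res_comp Z W Z g.hom g.inv x, g.inv_hom_id]
    exact D.res_id Z x
  rw [← key a, h, key]

lemma BigData.res_same (D : BigData P) {Z W : SieveCat H} (g : W ⟶ Z) (x : D.obj Z.obj) :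
    D.res _ _ ((SieveCat.same H).map g).hom (D.res _ _ (SieveCat.sameIso Z).hom.hom x) =
      D.res _ _ (SieveCat.sameIso W).hom.hom (D.res _ _ g.hom x) := by
  rw [← D.res_comp, ← D.res_comp]
  congr 2

/-- The restriction map of the standardization of `E` along `g` sends `s` to `t`. -/
def IsStandardizedRestriction {E : HPresheaf H}
    (φ : ∀ Y : SieveCat H, free (sieveRing (H.pullback (str Y.obj))) 1 ≅ E.pullback (str Y.obj))
    {Z W : SieveCat H} (g : W ⟶ Z) (s : Fin 1 → globRing Z.obj.left)
    (t : Fin 1 → globRing W.obj.left) : Prop :=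
  standardizeMap (n := fun _ => 1) φ g.op s = t

/-- The restriction map of `D` along `g` sends `a` to `b`. -/
def BigData.Sends (D : BigData P) {Z W : Over P} (g : W ⟶ Z) (a : D.obj Z) (b : D.obj W) : Prop :=
  b = D.res Z W g a

/-- Over each object `Y`, the isomorphism `φ` is given by the map `τ` on global sections. -/
def IsGivenBy (D : BigData P)
    (φ : ∀ Y : SieveCat H, free (sieveRing (H.pullback (str Y.obj))) 1 ≅
      (D.toBig.restrict H).pullback (str Y.obj))
    (τ : ∀ Y : SieveCat H, globRing Y.obj.left → D.obj Y.obj) : Prop :=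
  ∀ (Y : SieveCat H) (s : Fin 1 → globRing Y.obj.left),
    standardizeEquiv (n := fun _ => 1) φ Y s = D.res _ _ (SieveCat.sameIso Y).hom.hom (τ Y (s 0))

/-- The changes from `f` to `𝟙 ≫ f` commute with restriction and are injective, so they cancel from
both sides of the equation. -/
lemma IsGivenBy.isStandardizedRestriction_iff {D : BigData P}
    {φ : ∀ Y : SieveCat H, free (sieveRing (H.pullback (str Y.obj))) 1 ≅
      (D.toBig.restrict H).pullback (str Y.obj)}
    {τ : ∀ Y : SieveCat H, globRing Y.obj.left → D.obj Y.obj}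
    (hφ : IsGivenBy D φ τ)
    {Z W : SieveCat H} (g : W ⟶ Z) (s : Fin 1 → globRing Z.obj.left)
    (t : Fin 1 → globRing W.obj.left) :
    IsStandardizedRestriction φ g s t ↔ D.Sends g.hom (τ Z (s 0)) (τ W (t 0)) := by
  refine (standardizeMap_eq_iff (n := fun _ => 1) φ g.op s t).trans ?_
  have h := (congrArg (sameRestrict (D.toBig.restrict H) g.op) (hφ Z s)).trans
    ((sameRestrict_bigData D g _).trans (D.res_same g (τ Z (s 0))))
  exact (Eq.congr (hφ W t) h).trans
    (D.res_injective ((ObjectProperty.ι _).mapIso (SieveCat.sameIso W))).eq_iff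

lemma isGivenBy_trivializationIso
    (α : ∀ Y : SieveCat H, oMod Y.obj.left ≅ (Modules.pullback (str Y.obj)).obj M) :
    IsGivenBy (bigData M) (trivializationIso α) (fun Y a => secMap (α Y).hom (secUnit _ a)) :=
  standardizeEquiv_eq_res α

lemma bigData_sends_iff {Z W : Over P} (a : oMod Z.left ≅ (Modules.pullback (str Z)).obj M)
    (b : oMod W.left ≅ (Modules.pullback (str W)).obj M) (g : W ⟶ Z) (s : globRing Z.left)
    (t : globRing W.left) :
    (bigData M).Sends g (secMap a.hom (secUnit _ s)) (secMap b.hom (secUnit _ t)) ↔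
      Restricts a b g.left (str_w g) s t :=
  Eq.congr_right (bigData_res M g _)

lemma isStandardizedRestriction_trivializationIso_iff
    (α : ∀ Y : SieveCat H, oMod Y.obj.left ≅ (Modules.pullback (str Y.obj)).obj M)
    {Z W : SieveCat H} (g : W ⟶ Z) (s : Fin 1 → globRing Z.obj.left)
    (t : Fin 1 → globRing W.obj.left) :
    IsStandardizedRestriction (trivializationIso α) g s t ↔
      Restricts (α Z) (α W) g.hom.left (str_w g.hom) (s 0) (t 0) :=
  ((isGivenBy_trivializationIso α).isStandardizedRestriction_iff g s t).trans
    (bigData_sends_iff (α Z) (α W) g.hom (s 0) (t 0))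

end Trivialized

/-! ### Restriction maps of the standard `𝒪(n)` in terms of `Proj ℤ[x₀, …, x_r]`. -/

section Serre

open Scheme

variable {r : ℕ} {X Y : Scheme.{u}}

/-- The factorization of `Z ⟶ ℙ^r_X ⟶ Proj ℤ[x₀, …, x_r]` through the largest possible chart. -/
def toIntChart (Z : SieveCat (chartSieve r X)) :
    Z.obj.left ⟶ (intChart.{u} (chartIndex Z)).toScheme :=
  toChart Z ≫ chartToInt X (chartIndex Z)

lemma toIntChart_ι (Z : SieveCat (chartSieve r X)) :
    toIntChart Z ≫ (intChart.{u} (chartIndex Z)).ι = str Z.obj ≫ projSpace.toProj r X := by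
  rw [toIntChart, Category.assoc, ← chartToInt_ι, ← Category.assoc, toChart_ι]

/-- The isomorphism of `𝒪_Z` with the inverse image of `𝒪(n)` given by `x_k ^ n`, for a morphism `t` from
`Z` to `D₊(x_k)`. -/
def intTrivialization {Z : Scheme.{u}} (n : ℤ) (k : Fin (r + 1))
    (t : Z ⟶ (intChart.{u} k).toScheme) :
    oMod Z ≅ (Modules.pullback (t ≫ (intChart k).ι)).obj (intTwist r n) :=
  pullTrivialization t (intChart k).ι _ rfl (intTwist r n) (intChartTpow k n)

variable (r X) in
/-- The twisting sheaf on `ℙ^r_X` is the inverse image of the twisting sheaf on `Proj ℤ[x₀, …, x_r]`. -/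
def serreIso (n : ℤ) :
    serre r X n ≅ (Modules.pullback (projSpace.toProj r X)).obj (intTwist r n) :=
  Iso.refl _

lemma pullIso_serreIso {Z : Scheme.{u}} (n : ℤ) (h : Z ⟶ projSpace r X) (z : Z ⟶ projInt.{u} r)
    (w : h ≫ projSpace.toProj r X = z) :
    pullIso (serreIso r X n) h z w = cmp h (projSpace.toProj r X) z w (intTwist r n) := by
  ext1
  rw [pullIso, Iso.trans_hom, Functor.mapIso_hom, serreIso, Iso.refl_hom]
  exact (congrArg (· ≫ _) (CategoryTheory.Functor.map_id _ _)).trans (Category.id_comp _)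

/-- This puts the trivialization over `U_k` into the two-stage form required by
`pullTrivialization_trans`. -/
lemma chartTpow_eq (k : Fin (r + 1)) (n : ℤ) :
    chartTpow X k n = pullTrivialization (chartToInt X k) (intChart k).ι _ rfl (intTwist r n)
      (intChartTpow k n) ≪≫ (pullIso (serreIso r X n) (chart X k).ι _ (chartToInt_ι X k)).symm := by
  rw [chartTpow, pullTrivialization, Iso.trans_assoc, Iso.trans_assoc, pullIso_serreIso]
  rfl

lemma alpha_eq (n : ℤ) (Z : SieveCat (chartSieve r X)) :
    alpha n Z = pullTrivialization (toChart Z) (chart X (chartIndex Z)).ι (str Z.obj) (toChart_ι Z)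
      (serre r X n) (chartTpow X (chartIndex Z) n) := (rfl)

/-- After the canonical passage to the inverse image from `Proj`, the trivialization depends only on
the morphism from `Z` to `D₊(x_k)`, and no longer on `X`. -/
lemma alpha_pullIso (n : ℤ) (Z : SieveCat (chartSieve r X)) :
    (alpha n Z).hom ≫ (pullIso (serreIso r X n) (str Z.obj) _ (toIntChart_ι Z).symm).hom =
      (intTrivialization n (chartIndex Z) (toIntChart Z)).hom := by
  rw [alpha_eq, chartTpow_eq]
  exact pullTrivialization_trans (toChart Z) (chart X (chartIndex Z)).ι (str Z.obj) (toChart_ι Z)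
    (projSpace.toProj r X) (chartToInt X (chartIndex Z)) (intChart (chartIndex Z)).ι _ rfl
    (chartToInt_ι X (chartIndex Z)) _ (toIntChart_ι Z).symm (toIntChart Z) rfl rfl
    (serreIso r X n) (intChartTpow (chartIndex Z) n)

lemma comp_toIntChart_ι {Z W : SieveCat (chartSieve r X)} (g : W ⟶ Z) :
    g.hom.left ≫ toIntChart Z ≫ (intChart.{u} (chartIndex Z)).ι =
      toIntChart W ≫ (intChart.{u} (chartIndex W)).ι := by
  rw [toIntChart_ι, toIntChart_ι, ← Category.assoc, str_w]

/-- In the trivializations `x_k ^ n` and `x_l ^ n` of inverse images of `𝒪(n)` on `Proj ℤ[x₀, …, x_r]`,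
restriction along `g` sends `s` to `t`. -/
def RestrictsCharts {A B : Scheme.{u}} (n : ℤ) (g : B ⟶ A) (k l : Fin (r + 1))
    (a : A ⟶ (intChart.{u} k).toScheme) (b : B ⟶ (intChart.{u} l).toScheme) (s : globRing A)
    (t : globRing B) : Prop :=
  ∃ w : g ≫ a ≫ (intChart k).ι = b ≫ (intChart l).ι,
    Restricts (intTrivialization n k a) (intTrivialization n l b) g w s t

/-- The right-hand side involves `X` only through the largest indices and the morphisms to the
charts of `Proj`, so it can be compared for different bases. -/
lemma isStandardizedRestriction_phi_iff (n : ℤ) {Z W : SieveCat (chartSieve r X)} (g : W ⟶ Z)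
    (s : Fin 1 → globRing Z.obj.left) (t : Fin 1 → globRing W.obj.left) :
    IsStandardizedRestriction (phi n) g s t ↔
      RestrictsCharts n g.hom.left (chartIndex Z) (chartIndex W) (toIntChart Z) (toIntChart W)
        (s 0) (t 0) :=
  ((isStandardizedRestriction_trivializationIso_iff (alpha n) g s t).trans
    (restricts_trans_pullIso_iff (serreIso r X n) (toIntChart_ι Z).symm (toIntChart_ι W).symm
      (alpha n Z) (alpha n W) _ _ (alpha_pullIso n Z) (alpha_pullIso n W) g.hom.left
      (str_w g.hom) (comp_toIntChart_ι g) (s 0) (t 0))).trans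
    ⟨fun h => ⟨_, h⟩, fun ⟨_, h⟩ => h⟩

/-- The types of `a` and `b` depend on the indices, so agreement is stated for the composites to
`Proj`. Chart inclusions are monomorphisms, so once the indices are identified the factorizations
are equal. -/
lemma RestrictsCharts.congr {Z W : Scheme.{u}} {n : ℤ} {g : W ⟶ Z}
    {k l k' l' : Fin (r + 1)} (hk : k = k') (hl : l = l')
    {a : Z ⟶ (intChart.{u} k).toScheme} {b : W ⟶ (intChart.{u} l).toScheme}
    {a' : Z ⟶ (intChart.{u} k').toScheme} {b' : W ⟶ (intChart.{u} l').toScheme}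
    (ha : a ≫ (intChart k).ι = a' ≫ (intChart k').ι)
    (hb : b ≫ (intChart l).ι = b' ≫ (intChart l').ι)
    {s : globRing Z} {t : globRing W}
    (h : RestrictsCharts n g k l a b s t) : RestrictsCharts n g k' l' a' b' s t := by
  subst hk hl
  rw [cancel_mono] at ha hb
  subst ha hb
  exact h

end Serre

/-! ### Equality of the pullback with the standard `𝒪(n)` on `ℙ^r_Y`. -/

section Pullback

lemma standardizeMap_id {P : Scheme.{u}} {H : Sieve P} {E : HPresheaf H}
    (φ : ∀ Y : SieveCat H, free (sieveRing (H.pullback (str Y.obj))) 1 ≅ E.pullback (str Y.obj))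
    (Z : (SieveCat H)ᵒᵖ) : ActsAsId (standardizeMap (n := fun _ => 1) φ (𝟙 Z)) := fun _ =>
  (congrArg (standardizeEquiv φ Z.unop).symm (sameRestrict_id E Z _)).trans
    ((standardizeEquiv φ Z.unop).symm_apply_apply _)

lemma standardizeMap_comp {P : Scheme.{u}} {H : Sieve P} {E : HPresheaf H}
    (φ : ∀ Y : SieveCat H, free (sieveRing (H.pullback (str Y.obj))) 1 ≅ E.pullback (str Y.obj))
    {Z W V : (SieveCat H)ᵒᵖ} (g : Z ⟶ W) (k : W ⟶ V) :
    ActsAsComp (standardizeMap (n := fun _ => 1) φ g) (standardizeMap (n := fun _ => 1) φ k)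
      (standardizeMap (n := fun _ => 1) φ (g ≫ k)) := fun _ =>
  congrArg (standardizeEquiv φ V.unop).symm ((sameRestrict_comp E g k _).trans
    (congrArg (sameRestrict E k) ((standardizeEquiv φ W.unop).apply_symm_apply _).symm))

/-- Precomposition with `F` keeps the form `mkPresheaf` definitionally; only the functor laws need
proofs. This brings the pullback of a standardization into the shape that
`SievePair.mk_mkPresheaf_eq` compares. -/
lemma exists_pushforward_mkPresheaf_eq {C D : Type*} [Category C] [Category D] (F : C ⥤ D)
    (R : Dᵒᵖ ⥤ RingCat.{u}) (obj : ∀ Z : Dᵒᵖ, ModuleCat.{u} (R.obj Z))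
    (map : ∀ {Z W : Dᵒᵖ} (g : Z ⟶ W), obj Z →ₛₗ[(R.map g).hom] obj W)
    (map_id : ∀ Z : Dᵒᵖ, ActsAsId (map (𝟙 Z)))
    (map_comp : ∀ {Z W V : Dᵒᵖ} (g : Z ⟶ W) (k : W ⟶ V),
      ActsAsComp (map g) (map k) (map (g ≫ k))) :
    ∃ (map_id' : ∀ Z : Cᵒᵖ, ActsAsId (map (F.op.map (𝟙 Z))))
      (map_comp' : ∀ {Z W V : Cᵒᵖ} (g : Z ⟶ W) (k : W ⟶ V),
        ActsAsComp (map (F.op.map g)) (map (F.op.map k)) (map (F.op.map (g ≫ k)))),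
      (PresheafOfModules.pushforward₀ F R).obj (mkPresheaf R obj map map_id map_comp) =
        mkPresheaf (F.op ⋙ R) (fun Z => obj (F.op.obj Z)) (fun g => map (F.op.map g))
          map_id' map_comp' := by
  refine ⟨fun Z s => ?_, fun g k s => ?_, rfl⟩
  · exact (congrArg (fun k => map k s) (F.op.map_id Z)).trans (map_id _ s)
  · exact (congrArg (fun k => map k s) (F.op.map_comp g k)).trans (map_comp _ _ s)

/-- The pullback of a standardization is equal to another standardization if the sieves are equal and
the restriction maps agree. -/
lemma SievePair.pullback_standardize_eq {P Q : Scheme.{u}} (q : Q ⟶ P) {H : Sieve P} {H' : Sieve Q}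
    (hH : H.pullback q = H') {E : HPresheaf H} {E' : HPresheaf H'}
    (φ : ∀ Y : SieveCat H, free (sieveRing (H.pullback (str Y.obj))) 1 ≅ E.pullback (str Y.obj))
    (φ' : ∀ Y : SieveCat H', free (sieveRing (H'.pullback (str Y.obj))) 1 ≅ E'.pullback (str Y.obj))
    (h : ∀ (Z W : Over Q) (hZ : (H.pullback q).arrows Z.hom) (hW : (H.pullback q).arrows W.hom)
      (hZ' : H'.arrows Z.hom) (hW' : H'.arrows W.hom) (g : W ⟶ Z) (s : Fin 1 → globRing Z.left)
      (t : Fin 1 → globRing W.left),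
      IsStandardizedRestriction φ' (Z := ⟨Z, hZ'⟩) (W := ⟨W, hW'⟩) (ObjectProperty.homMk g) s t →
      IsStandardizedRestriction φ ((SieveCat.post q H).map (X := ⟨W, hW⟩) (Y := ⟨Z, hZ⟩)
        (ObjectProperty.homMk g)) s t) :
    (SievePair.mk H (standardize E (fun _ => 1) φ)).pullback q =
      SievePair.mk H' (standardize E' (fun _ => 1) φ') := by
  obtain ⟨_, _, e⟩ := exists_pushforward_mkPresheaf_eq (SieveCat.post q H) (sieveRing H)
    (fun Y => ModuleCat.of ((sieveRing H).obj Y) (Fin 1 → (sieveRing H).obj Y))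
    (fun g => standardizeMap (n := fun _ => 1) φ g) (standardizeMap_id φ) (standardizeMap_comp φ)
  exact (congrArg (SievePair.mk (H.pullback q)) e).trans
    (SievePair.mk_mkPresheaf_eq hH _ _ _ _ (standardizeMap_id φ') (standardizeMap_comp φ')
      -- The relations are graphs of functions, so one implication suffices: take `t` to be the
      -- value of the restriction map for `φ'`.
      fun Z W hZ hW hZ' hW' g s => h Z W hZ hW hZ' hW' g s _ rfl)

lemma stdTwist_isStandardLineBundle (r : ℕ) (X : Scheme.{u}) (n : ℤ) :
    (stdTwist r X n).IsStandardLineBundle :=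
  ⟨chartSieve_mem_zariskiTopology r X, isStandardFreeAt_standardize _ (fun _ => 1) (phi n)⟩

variable {r : ℕ} {X Y : Scheme.{u}} {f : Y ⟶ X}

lemma chartIndex_post
    (V : SieveCat ((chartSieve r X).pullback (projSpace.map r f))) (V' : SieveCat (chartSieve r Y))
    (hV : V'.obj = V.obj) :
    chartIndex V' = chartIndex ((SieveCat.post (projSpace.map r f) (chartSieve r X)).obj V) := by
  refine chartIndex_eq _ _ fun k => ?_
  rw [hV]
  exact (factorsThroughChart_comp_map f (str V.obj) k).symm

lemma str_post_toProj
    (V : SieveCat ((chartSieve r X).pullback (projSpace.map r f))) :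
    str ((SieveCat.post (projSpace.map r f) (chartSieve r X)).obj V).obj ≫ projSpace.toProj r X =
      str V.obj ≫ projSpace.toProj r Y := by
  change (str V.obj ≫ projSpace.map r f) ≫ _ = _
  rw [Category.assoc, projSpace.map_toProj]

/-- The restriction maps of `𝒪(n)` on `ℙ^r_Y` are restriction maps of `𝒪(n)` on `ℙ^r_X`. -/
lemma isStandardizedRestriction_phi_post (n : ℤ) {Z W : Over (projSpace r Y)}
    (hZ : ((chartSieve r X).pullback (projSpace.map r f)).arrows Z.hom)
    (hW : ((chartSieve r X).pullback (projSpace.map r f)).arrows W.hom)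
    (hZ' : (chartSieve r Y).arrows Z.hom) (hW' : (chartSieve r Y).arrows W.hom)
    (g : W ⟶ Z) (s : Fin 1 → globRing Z.left) (t : Fin 1 → globRing W.left)
    (h : IsStandardizedRestriction (phi n) (Z := ⟨Z, hZ'⟩) (W := ⟨W, hW'⟩)
      (ObjectProperty.homMk g) s t) :
    IsStandardizedRestriction (phi n) ((SieveCat.post (projSpace.map r f) (chartSieve r X)).map
      (X := ⟨W, hW⟩) (Y := ⟨Z, hZ⟩) (ObjectProperty.homMk g)) s t := by
  refine (isStandardizedRestriction_phi_iff n
    ((SieveCat.post (projSpace.map r f) (chartSieve r X)).map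
      (X := ⟨W, hW⟩) (Y := ⟨Z, hZ⟩) (ObjectProperty.homMk g)) s t).mpr ?_
  have h' := (isStandardizedRestriction_phi_iff n (Z := ⟨Z, hZ'⟩) (W := ⟨W, hW'⟩)
    (ObjectProperty.homMk g) s t).mp h
  -- The largest indices agree, and each factorization composes with its chart inclusion to the same
  -- morphism to `Proj`.
  exact h'.congr (chartIndex_post ⟨Z, hZ⟩ ⟨Z, hZ'⟩ rfl) (chartIndex_post ⟨W, hW⟩ ⟨W, hW'⟩ rfl)
    ((toIntChart_ι ⟨Z, hZ'⟩).trans ((str_post_toProj ⟨Z, hZ⟩).symm.trans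
      (toIntChart_ι ((SieveCat.post (projSpace.map r f) (chartSieve r X)).obj ⟨Z, hZ⟩)).symm))
    ((toIntChart_ι ⟨W, hW'⟩).trans ((str_post_toProj ⟨W, hW⟩).symm.trans
      (toIntChart_ι ((SieveCat.post (projSpace.map r f) (chartSieve r X)).obj ⟨W, hW⟩)).symm))

end Pullback

end StdBundle

end

theorem proposition3p10 (r : ℕ) (n : ℤ) {X Y : Scheme.{u}} (f : Y ⟶ X) :
    (StdBundle.stdTwist r X n).IsStandardLineBundle ∧
      (StdBundle.stdTwist r Y n).IsStandardLineBundle ∧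
      (StdBundle.stdTwist r X n).pullback (StdBundle.projSpace.map r f) =
        StdBundle.stdTwist r Y n :=
  ⟨StdBundle.stdTwist_isStandardLineBundle r X n, StdBundle.stdTwist_isStandardLineBundle r Y n,
    StdBundle.SievePair.pullback_standardize_eq (StdBundle.projSpace.map r f)
      (StdBundle.chartSieve_pullback r f) (StdBundle.phi n) (StdBundle.phi n)
      fun _ _ hZ hW hZ' hW' => StdBundle.isStandardizedRestriction_phi_post n hZ hW hZ' hW'⟩
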